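/- Conventions. Write $\langle\xi\rangle=(1+|\xi|^2)^{1/2}$ for $\xi\in\mathbb R^n$, and use the Fourier transform normalized by $\widehat u(\xi)=\int e^{-i\langle x,\xi\rangle}u(x)\,dx$. Let $\mathcal K_{pol}(\mathbb R^n)$ be the set of measurable functions $k:\mathbb R^n\to(0,\infty)$ for which there are constants $C,N>0$ with $k(\xi+\eta)\le C\langle\xi\rangle^N k(\eta)$ for all $\xi,\eta$. Let $\mathcal K_a(\mathbb R^n)$ be the set of $k\in\mathcal K_{pol}(\mathbb R^n)$ such that $k^{-2}*k^{-2}\le C^2k^{-2}$ for some $C>0$. Let $\mathcal K_{WL}(\mathbb R^n)$ be the set of $k\in\mathcal K_a(\mathbb R^n)$ for which there are $\delta\in(0,1)$ and $C>0$ such that $k^\delta\in\mathcal K_a(\mathbb R^n)$, $k^{-\delta}\in L^2(\mathbb R^n)$ and $k^{-2\delta}*\underline k^{-2}\le C^2\,\underline k^{-2}$, where $\underline k=\langle\cdot\rangle^{-1}k$. For $k\in\mathcal K_{pol}(\mathbb R^n)$, let $\mathcal B_k(\mathbb R^n)$ be the space of all $u\in\mathcal S'(\mathbb R^n)$ such that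 $\widehat u$ is a function and $k\widehat u\in L^2(\mathbb R^n)$, with norm $\|u\|_{\mathcal B_k}=\|k\widehat u\|_{L^2}$. Let $\mathcal B_k^\infty(\mathbb R^n)$ be the space of all distributions $u\in\mathcal D'(\mathbb R^n)$ for which there is $\chi\in\mathcal C_0^\infty(\mathbb R^n)\setminus\{0\}$ such that $u\,\chi(\cdot-y)\in\mathcal B_k(\mathbb R^n)$ for every $y\in\mathbb R^n$ and $\sup_{y}\|u\,\chi(\cdot-y)\|_{\mathcal B_k}<\infty$. A continuous function on $\mathbb R^n$ is identified with the distribution it defines. Theorem (Wiener–Lévy for $\mathcal B_k^\infty$). Let $k\in\mathcal K_{WL}(\mathbb R^n)$, let $\Omega\subset\mathbb C^d$ be open and $\Phi:\Omega\to\mathbb C$ holomorphic, and let $u=(u_1,\dots,u_d)\in\mathcal B_k^\infty(\mathbb R^n)^d$. Then each $u_j$ is a bounded continuous function, so that $u$ is a bounded continuous map $\mathbb R^n\to\mathbb C^d$; and if $\overline{u(\mathbb R^n)}\subset\Omega$, then $\Phi\circ u\in\mathcal B_k^\infty(\mathbb R^n)$. -/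

import Mathlib

open MeasureTheory TopologicalSpace
open scoped ENNReal Distributions SchwartzMap FourierTransform ContDiff

noncomputable section

namespace KatoSobolev

/-- The Euclidean space `ℝⁿ`. -/
abbrev Rn (n : ℕ) : Type := EuclideanSpace ℝ (Fin n)

/-- `𝒞₀^∞(ℝⁿ)`: complex-valued smooth functions with compact support, with its LF topology. -/
abbrev Test (n : ℕ) : Type := 𝓓((⊤ : Opens (Rn n)), ℂ)

/-- `𝒟'(ℝⁿ)`: continuous complex-linear forms on `𝒞₀^∞(ℝⁿ)`. -/
abbrev Distr (n : ℕ) : Type := Test n →L[ℂ] ℂ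

/-! ### Weight functions -/

/-- `⟨ξ⟩ = (1 + |ξ|²)^{1/2}`. -/
def bracket {n : ℕ} (ξ : Rn n) : ℝ := Real.sqrt (1 + ‖ξ‖ ^ 2)

/-- `𝒦_pol(ℝⁿ)`: weight functions of polynomial growth. -/
def Kpol (n : ℕ) : Set (Rn n → ℝ) :=
  {k | Measurable k ∧ (∀ ξ, 0 < k ξ) ∧
    ∃ C N : ℝ, 0 < C ∧ 0 < N ∧ ∀ ξ η, k (ξ + η) ≤ C * bracket ξ ^ N * k η}

/-- `k₁⁻² ∗ k₂⁻² ≤ C² k⁻²` pointwise, for some constant `C > 0`. The convolution of the nonnegative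
functions is computed in `[0, ∞]`, so that its finiteness is part of the condition. -/
def ConvLE {n : ℕ} (k₁ k₂ k : Rn n → ℝ) : Prop :=
  ∃ C : ℝ, 0 < C ∧ ∀ ξ,
    ∫⁻ η, ENNReal.ofReal (1 / k₁ η ^ 2) * ENNReal.ofReal (1 / k₂ (ξ - η) ^ 2)
      ≤ ENNReal.ofReal (C ^ 2 / k ξ ^ 2)

/-- `𝒦_a(ℝⁿ)`: the weights `k ∈ 𝒦_pol` with `k⁻² ∗ k⁻² ≤ C² k⁻²`. -/
def Ka (n : ℕ) : Set (Rn n → ℝ) := {k | k ∈ Kpol n ∧ ConvLE k k k}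

/-- `𝒦_WL(ℝⁿ)`: the weights `k ∈ 𝒦_a` for which there is `δ ∈ (0, 1)` with `k^δ ∈ 𝒦_a`,
`k^{-δ} ∈ L²` and `k^{-2δ} ∗ (⟨·⟩⁻¹k)⁻² ≤ C² (⟨·⟩⁻¹k)⁻²`. -/
def KWL (n : ℕ) : Set (Rn n → ℝ) :=
  {k | k ∈ Ka n ∧ ∃ δ : ℝ, 0 < δ ∧ δ < 1 ∧ (fun ξ => k ξ ^ δ) ∈ Ka n ∧
    MemLp (fun ξ => k ξ ^ (-δ)) 2 volume ∧
    ConvLE (fun ξ => k ξ ^ δ) (fun ξ => (bracket ξ)⁻¹ * k ξ) (fun ξ => (bracket ξ)⁻¹ * k ξ)}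

/-! ### The space `ℬ_k = B_{2,k}` -/

/-- The Fourier transform of `T ∈ 𝒮'(ℝⁿ)` is the (locally integrable) function `g`, with the
normalization `û(ξ) = ∫ e^{-i⟨x,ξ⟩} u(x) dx`. Mathlib's `𝓕` uses `e^{-2πi⟨x,ξ⟩}`, so that
`𝓕 T` is then the function `ξ ↦ g (2πξ)`. -/
def IsFourierTransform {n : ℕ} (T : 𝓢'(Rn n, ℂ)) (g : Rn n → ℂ) : Prop :=
  LocallyIntegrable g volume ∧
    ∀ φ : 𝓢(Rn n, ℂ), (𝓕 T) φ = ∫ ξ, φ ξ * g ((2 * Real.pi) • ξ)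

/-- `ℬ_k(ℝⁿ)`: the tempered distributions `T` such that the Fourier transform of `T` is a function
`g` with `k g ∈ L²`. -/
def Bk {n : ℕ} (k : Rn n → ℝ) : Set 𝓢'(Rn n, ℂ) :=
  {T | ∃ g, IsFourierTransform T g ∧ MemLp (fun ξ => (k ξ : ℂ) * g ξ) 2 volume}

/-- `‖T‖_{ℬ_k} = ‖k g‖_{L²}` where the function `g` is the Fourier transform of `T`. Such a `g` is
unique almost everywhere, so the infimum runs over equal numbers; it is `∞` if there is no `g`. -/
def normBk {n : ℕ} (k : Rn n → ℝ) (T : 𝓢'(Rn n, ℂ)) : ℝ≥0∞ :=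
  ⨅ (g : Rn n → ℂ) (_ : IsFourierTransform T g), eLpNorm (fun ξ => (k ξ : ℂ) * g ξ) 2 volume

/-! ### Localization of distributions -/

/-- The translate `τ_y χ = χ(· - y)` of a test function. -/
def translate {n : ℕ} (y : Rn n) (χ : Test n) : Test n where
  toFun x := χ (x - y)
  contDiff' := χ.contDiff.comp (contDiff_id.sub contDiff_const)
  hasCompactSupport' := χ.hasCompactSupport.comp_homeomorph (Homeomorph.subRight y)
  tsupport_subset' := fun _ _ => trivial

/-- The support of a test function as a bundled compact set. -/
def supp {n : ℕ} (χ : Test n) : Compacts (Rn n) := ⟨tsupport χ, χ.hasCompactSupport⟩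

/-- Multiplication by the test function `χ`, from the Schwartz space to smooth functions supported
in `supp χ`. -/
def mulLM {n : ℕ} (χ : Test n) : 𝓢(Rn n, ℂ) →ₗ[ℂ] 𝓓_{supp χ}(Rn n, ℂ) where
  toFun φ :=
    { toFun := fun x => χ x * φ x
      contDiff' := χ.contDiff.mul (φ.smooth ⊤)
      zero_on_compl' := fun x hx => by
        have : χ x = 0 := image_eq_zero_of_notMem_tsupport hx
        simp [this] }
  map_add' φ ψ := by
    ext x
    exact mul_add (χ x) (φ x) (ψ x)
  map_smul' c φ := by
    ext x
    exact mul_left_comm (χ x) c (φ x)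

theorem hasTemperateGrowth {n : ℕ} (χ : Test n) : (χ : Rn n → ℂ).HasTemperateGrowth :=
  (χ.hasCompactSupport.toSchwartzMap χ.contDiff).hasTemperateGrowth

theorem continuous_mulLM {n : ℕ} (χ : Test n) : Continuous (mulLM χ) := by
  refine WithSeminorms.continuous_of_continuous_comp
    (ContDiffMapSupportedIn.withSeminorms ℂ (Rn n) ℂ ⊤ (supp χ)) (mulLM χ) fun i => ?_
  let q : Seminorm ℂ 𝓢(Rn n, ℂ) :=
    (SchwartzMap.seminorm ℂ 0 i).comp (SchwartzMap.smulLeftCLM ℂ (χ : Rn n → ℂ)).toLinearMap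
  have hq : Continuous q :=
    ((schwartz_withSeminorms ℂ (Rn n) ℂ).continuous_seminorm (0, i)).comp
      (SchwartzMap.smulLeftCLM ℂ (χ : Rn n → ℂ)).continuous
  refine Seminorm.continuous_of_le hq fun φ => ?_
  refine (ContDiffMapSupportedIn.seminorm_top_le_iff ℂ (apply_nonneg q φ) i (mulLM χ φ)).2
    fun x _ => ?_
  have h : (mulLM χ φ : Rn n → ℂ) = SchwartzMap.smulLeftCLM ℂ (χ : Rn n → ℂ) φ := by
    ext x
    rw [SchwartzMap.smulLeftCLM_apply_apply (hasTemperateGrowth χ)]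
    rfl
  rw [h]
  exact SchwartzMap.norm_iteratedFDeriv_le_seminorm ℂ _ i x

/-- The product `χu ∈ 𝒮'(ℝⁿ)` of a distribution `u` with a test function `χ`:
`⟨χu, φ⟩ = ⟨u, χφ⟩` for `φ ∈ 𝒮(ℝⁿ)`. -/
def cutoff {n : ℕ} (χ : Test n) (u : Distr n) : 𝓢'(Rn n, ℂ) :=
  ContinuousLinearMap.toPointwiseConvergenceCLM _ _ _ _
    (u.comp ((TestFunction.ofSupportedInCLM ℂ (Ω := (⊤ : Opens (Rn n))) (fun _ _ => trivial)).comp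
      (⟨mulLM χ, continuous_mulLM χ⟩ : 𝓢(Rn n, ℂ) →L[ℂ] 𝓓_{supp χ}(Rn n, ℂ))))

/-! ### The space `ℬ_k^∞` -/

/-- `ℬ_k^∞(ℝⁿ)`: the distributions `u` such that, for some test function `χ ≠ 0`, all `u τ_yχ`
belong to `ℬ_k` and `sup_y ‖u τ_yχ‖_{ℬ_k} < ∞`. -/
def BkInfty {n : ℕ} (k : Rn n → ℝ) : Set (Distr n) :=
  {u | ∃ χ : Test n, χ ≠ 0 ∧ (∀ y, cutoff (translate y χ) u ∈ Bk k) ∧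
    ⨆ y, normBk k (cutoff (translate y χ) u) < ⊤}

/-- The distribution `φ ↦ ∫ φ f` defined by a locally integrable function `f`. -/
def ofFun {n : ℕ} (f : Rn n → ℂ) : Distr n :=
  TestFunction.integralAgainstBilinCLM (ContinuousLinearMap.mul ℂ ℂ) volume f

end KatoSobolev

end

/-!
For a weight `w` of the Wiener-Lévy class the space `𝓑_w` is a Banach algebra of bounded continuous
functions, and so is `𝓑_v` for `v = w ^ δ + l w`, with a constant independent of `l > 0`, although
the norms for different `l` are equivalent.

The heart of the matter is a spectral radius estimate: if `g` lies in a fixed ball of `𝓑_w` and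
`|g| ≤ σ`, then for small `l` the powers `g ^ m` act on `𝓑_v` with norm at most `D (4 σ) ^ m`, where
`D` does not depend on `g`. As `δ < 1`, the weight `v` is at most `2 l w` far from the origin, so
truncating the spectrum of `g` at a large radius `R` splits it into `a + h`, where `h` is small in
`𝓑_v` and hence in the sup norm. The function `a` is band-limited with `|a| ≤ 2 σ`. The spectrum of
`a ^ j` lies in the ball of radius `j R`, where `v` grows only polynomially in `j`, and by
Plancherel's identity the powers of `a` are controlled by `2 σ` up to a polynomial factor.

Localization makes the oscillation small: the elements of `𝓑_w^∞` are uniformly continuous, and for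
a cutoff `χ` of small support the functions `χ(· - z) (f - f z)` have small sup norm and lie in one
ball of `𝓑_w`. The Taylor series of `Φ` at `f z` can therefore be summed on the support of a
translated cutoff function, with bounds uniform in `z`.
-/

noncomputable section

namespace KatoSobolev

open scoped NNReal Convolution

section CauchySchwarz

variable {α : Type*} [MeasurableSpace α] {μ : Measure α}

theorem sq_lintegral_mul_le {f g : α → ℝ≥0∞} (hf : AEMeasurable f μ) (hg : AEMeasurable g μ) :
    (∫⁻ x, f x * g x ∂μ) ^ 2 ≤ (∫⁻ x, f x ^ 2 ∂μ) * ∫⁻ x, g x ^ 2 ∂μ := by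
  have holder := ENNReal.lintegral_mul_le_Lp_mul_Lq μ Real.HolderConjugate.two_two hf hg
  calc (∫⁻ x, f x * g x ∂μ) ^ 2
      ≤ ((∫⁻ x, f x ^ (2 : ℝ) ∂μ) ^ (1 / 2 : ℝ) * (∫⁻ x, g x ^ (2 : ℝ) ∂μ) ^ (1 / 2 : ℝ)) ^ 2 := by
        gcongr; exact holder
    _ = _ := by
        rw [mul_pow, ← ENNReal.rpow_natCast, ← ENNReal.rpow_natCast, ← ENNReal.rpow_mul,
          ← ENNReal.rpow_mul]
        simp

theorem eLpNorm_two_sq {E : Type*} [NormedAddCommGroup E] (f : α → E) :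
    eLpNorm f 2 μ ^ 2 = ∫⁻ x, ‖f x‖ₑ ^ 2 ∂μ := by
  simpa using eLpNorm_nnreal_pow_eq_lintegral (f := f) (μ := μ) (p := 2) two_ne_zero

theorem eLpNorm_two_le_iff {E : Type*} [NormedAddCommGroup E] {f : α → E} {M : ℝ≥0∞} :
    eLpNorm f 2 μ ≤ M ↔ ∫⁻ x, ‖f x‖ₑ ^ 2 ∂μ ≤ M ^ 2 := by
  rw [← eLpNorm_two_sq, ENNReal.pow_le_pow_left_iff two_ne_zero]

end CauchySchwarz

theorem lintegral_lintegral_mul_sub {G : Type*} [AddGroup G] [MeasurableSpace G]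
    [MeasurableAdd₂ G] [MeasurableNeg G] {μ : Measure G} [SFinite μ] [μ.IsAddRightInvariant]
    {a b : G → ℝ≥0∞} (ha : AEMeasurable a μ) (hb : AEMeasurable b μ) :
    ∫⁻ ξ, ∫⁻ η, a η * b (ξ - η) ∂μ ∂μ = (∫⁻ η, a η ∂μ) * ∫⁻ ξ, b ξ ∂μ := by
  rw [lintegral_lintegral_swap (ha.comp_snd.mul
    (hb.comp_quasiMeasurePreserving (quasiMeasurePreserving_sub_of_right_invariant μ μ))),
    ← lintegral_mul_const'' _ ha]
  refine lintegral_congr fun η => ?_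
  have hbη : AEMeasurable (fun ξ => b (ξ - η)) μ := hb.comp_quasiMeasurePreserving
    (measurePreserving_sub_right μ η).quasiMeasurePreserving
  rw [lintegral_const_mul'' _ hbη, lintegral_sub_right_eq_self b η]

section FourierInv

variable {V : Type*} [NormedAddCommGroup V] [InnerProductSpace ℝ V] [FiniteDimensional ℝ V]
  [MeasurableSpace V] [BorelSpace V]

theorem continuous_fourierInv_of_integrable {G : V → ℂ} (hG : Integrable G) :
    Continuous (𝓕⁻ G) := by
  have continuous_fourier : Continuous (𝓕 G) := VectorFourier.fourierIntegral_continuous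
    Real.continuous_fourierChar (by exact continuous_inner) hG
  exact (continuous_fourier.comp continuous_neg).congr fun x =>
    (Real.fourierInv_eq_fourier_neg G x).symm

theorem fourierInv_add_of_integrable {G₁ G₂ : V → ℂ} (h₁ : Integrable G₁) (h₂ : Integrable G₂) :
    𝓕⁻ (G₁ + G₂) = 𝓕⁻ G₁ + 𝓕⁻ G₂ := by
  ext x
  have integrable_char {G : V → ℂ} (hG : Integrable G) :
      Integrable fun ξ => Real.fourierChar (inner ℝ ξ x) • G ξ := by
    simpa using (Real.fourierIntegral_convergent_iff (-x)).2 hG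
  simp only [Real.fourierInv_eq, Pi.add_apply, smul_add]
  exact integral_add (integrable_char h₁) (integrable_char h₂)

theorem fourierInv_const_smul (c : ℂ) (G : V → ℂ) : 𝓕⁻ (c • G) = c • 𝓕⁻ G := by
  ext x
  simp only [Real.fourierInv_eq, Pi.smul_apply, smul_comm _ c, integral_smul]

theorem fourierInv_convolution {G₁ G₂ : V → ℂ} (h₁ : Integrable G₁) (h₂ : Integrable G₂) :
    𝓕⁻ (G₁ ⋆[ContinuousLinearMap.mul ℂ ℂ] G₂) = 𝓕⁻ G₁ * 𝓕⁻ G₂ := by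
  ext x
  simp only [Real.fourierInv_eq_fourier_neg, Pi.mul_apply, Real.fourier_mul_convolution_eq h₁ h₂]

theorem fourierInv_comp_sub (G : V → ℂ) (y : V) :
    (fun x => 𝓕⁻ G (x - y)) = 𝓕⁻ fun ξ => Real.fourierChar (-inner ℝ ξ y) • G ξ := by
  ext x
  simp only [Real.fourierInv_eq, smul_smul, ← AddChar.map_add_eq_mul, ← sub_eq_add_neg,
    inner_sub_right]

theorem norm_fourierInv_le_integral_norm (G : V → ℂ) (x : V) : ‖𝓕⁻ G x‖ ≤ ∫ ξ, ‖G ξ‖ := by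
  rw [Real.fourierInv_eq]
  simpa only [Circle.norm_smul] using norm_integral_le_integral_norm
    fun ξ => Real.fourierChar (inner ℝ ξ x) • G ξ

end FourierInv

section Weights

variable {V : Type*} [MeasurableSpace V]

/-- A weight: a measurable function with positive values. -/
structure IsWeight (v : V → ℝ) : Prop where
  measurable : Measurable v
  pos : ∀ ξ, 0 < v ξ

namespace IsWeight

variable {v : V → ℝ}

theorem aestronglyMeasurable (hv : IsWeight v) {μ : Measure V} :
    AEStronglyMeasurable (fun ξ => (v ξ : ℂ)) μ :=
  (Complex.measurable_ofReal.comp hv.measurable).aestronglyMeasurable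

theorem ofReal_ne_zero (hv : IsWeight v) (ξ : V) : (v ξ : ℂ) ≠ 0 :=
  Complex.ofReal_ne_zero.2 (hv.pos ξ).ne'

theorem enorm_ofReal_mul (hv : IsWeight v) (z : ℂ) (ξ : V) :
    ‖(v ξ : ℂ) * z‖ₑ = ENNReal.ofReal (v ξ) * ‖z‖ₑ := by
  rw [enorm_mul, ← ofReal_norm, Complex.norm_real, Real.norm_of_nonneg (hv.pos ξ).le]

theorem ofReal_inv_mul_ofReal (hv : IsWeight v) (ξ : V) :
    ENNReal.ofReal (v ξ)⁻¹ * ENNReal.ofReal (v ξ) = 1 := by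
  rw [← ENNReal.ofReal_mul (inv_nonneg.2 (hv.pos ξ).le), inv_mul_cancel₀ (hv.pos ξ).ne',
    ENNReal.ofReal_one]

theorem ofReal_inv_sq (hv : IsWeight v) (ξ : V) :
    ENNReal.ofReal (v ξ)⁻¹ ^ 2 = ENNReal.ofReal (1 / v ξ ^ 2) := by
  rw [← ENNReal.ofReal_pow (inv_nonneg.2 (hv.pos ξ).le), inv_pow, one_div]

end IsWeight

end Weights

/-- `v₁⁻² ∗ v₂⁻² ≤ C² v⁻²` pointwise, the convolution being computed in `[0, ∞]`: the condition
`ConvLE` with an explicit constant. -/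
def ConvLEWith {G : Type*} [MeasureSpace G] [AddGroup G] (C : ℝ≥0) (v₁ v₂ v : G → ℝ) : Prop :=
  ∀ ξ, ∫⁻ η, ENNReal.ofReal (1 / v₁ η ^ 2) * ENNReal.ofReal (1 / v₂ (ξ - η) ^ 2)
    ≤ ENNReal.ofReal (C ^ 2 / v ξ ^ 2)

section WeightedSpaces

variable {V : Type*} [NormedAddCommGroup V] [InnerProductSpace ℝ V] [FiniteDimensional ℝ V]
  [MeasurableSpace V] [BorelSpace V]

/-- `v` is a weight for which `𝓑_v` is a Banach algebra of continuous functions: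
`‖v⁻¹‖_{L²} ≤ C` and `v⁻² ∗ v⁻² ≤ C² v⁻²`. -/
structure IsAlgebraWeight (v : V → ℝ) (C : ℝ≥0) : Prop extends IsWeight v where
  eLpNorm_inv_le : eLpNorm (fun ξ => (v ξ : ℂ)⁻¹) 2 volume ≤ C
  convLE : ConvLEWith C v v v

/-- `g` is the inverse Fourier transform of the integrable function `G`, and `‖v G‖_{L²} ≤ M`.
Here `𝓕⁻` is Mathlib's, so that `v` lives on the frequencies `ξ / 2π` of the informal text. -/
structure HasSpectrum (v : V → ℝ) (g G : V → ℂ) (M : ℝ≥0) : Prop where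
  integrable : Integrable G
  eLpNorm_le : eLpNorm (fun ξ => (v ξ : ℂ) * G ξ) 2 volume ≤ M
  eq_fourierInv : g = 𝓕⁻ G

/-- `g` belongs to the closed ball of radius `M` of the space `𝓑_v`. Working with balls instead of
a norm avoids the uniqueness of the Fourier transform. -/
def MemBall (v : V → ℝ) (g : V → ℂ) (M : ℝ≥0) : Prop := ∃ G, HasSpectrum v g G M

variable {v v' v₁ v₂ : V → ℝ} {C M M' M₁ M₂ : ℝ≥0} {f g g₁ g₂ G G₁ G₂ : V → ℂ}

namespace ConvLEWith

theorem sq_mul_lintegral_le (h : ConvLEWith C v₁ v₂ v) (hv₁ : IsWeight v₁) (hv₂ : IsWeight v₂)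
    (hv : IsWeight v) {a b : V → ℝ≥0∞} (ha : AEMeasurable a) (hb : AEMeasurable b) (ξ : V) :
    (ENNReal.ofReal (v ξ) * ∫⁻ η, a η * b (ξ - η)) ^ 2 ≤
      C ^ 2 * ∫⁻ η, (ENNReal.ofReal (v₁ η) * a η) ^ 2 *
        (ENNReal.ofReal (v₂ (ξ - η)) * b (ξ - η)) ^ 2 := by
  let p η := ENNReal.ofReal (v₁ η)⁻¹ * ENNReal.ofReal (v₂ (ξ - η))⁻¹
  let q η := ENNReal.ofReal (v₁ η) * a η * (ENNReal.ofReal (v₂ (ξ - η)) * b (ξ - η))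
  have quasi : Measure.QuasiMeasurePreserving (fun η => ξ - η) volume volume :=
    (Measure.measurePreserving_sub_left volume ξ).quasiMeasurePreserving
  have hp : AEMeasurable p := (hv₁.measurable.inv.ennreal_ofReal.mul
    (hv₂.measurable.inv.ennreal_ofReal.comp (measurable_const.sub measurable_id))).aemeasurable
  have hq : AEMeasurable q := (hv₁.measurable.ennreal_ofReal.aemeasurable.mul ha).mul
    ((hv₂.measurable.ennreal_ofReal.aemeasurable.mul hb).comp_quasiMeasurePreserving quasi)
  have factor η : a η * b (ξ - η) = p η * q η := by
    calc a η * b (ξ - η) = (ENNReal.ofReal (v₁ η)⁻¹ * ENNReal.ofReal (v₁ η)) *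
          (ENNReal.ofReal (v₂ (ξ - η))⁻¹ * ENNReal.ofReal (v₂ (ξ - η))) *
            (a η * b (ξ - η)) := by
          rw [hv₁.ofReal_inv_mul_ofReal, hv₂.ofReal_inv_mul_ofReal, one_mul, one_mul]
      _ = p η * q η := by ring
  have p_sq : ∫⁻ η, p η ^ 2 ≤ ENNReal.ofReal (C ^ 2 / v ξ ^ 2) := by
    simpa only [p, mul_pow, hv₁.ofReal_inv_sq, hv₂.ofReal_inv_sq] using h ξ
  have cancel : ENNReal.ofReal (v ξ) ^ 2 * ENNReal.ofReal (C ^ 2 / v ξ ^ 2) = C ^ 2 := by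
    rw [← ENNReal.ofReal_pow (hv.pos ξ).le, ← ENNReal.ofReal_mul (by positivity),
      mul_div_cancel₀ _ (pow_pos (hv.pos ξ) 2).ne', ENNReal.ofReal_pow C.coe_nonneg,
      ENNReal.ofReal_coe_nnreal]
  calc (ENNReal.ofReal (v ξ) * ∫⁻ η, a η * b (ξ - η)) ^ 2
      = ENNReal.ofReal (v ξ) ^ 2 * (∫⁻ η, p η * q η) ^ 2 := by simp only [mul_pow, factor]
    _ ≤ ENNReal.ofReal (v ξ) ^ 2 * (ENNReal.ofReal (C ^ 2 / v ξ ^ 2) * ∫⁻ η, q η ^ 2) := by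
        gcongr
        exact (sq_lintegral_mul_le hp hq).trans (by gcongr)
    _ = C ^ 2 * ∫⁻ η, q η ^ 2 := by rw [← mul_assoc, cancel]
    _ = _ := by simp only [q, mul_pow]

theorem lintegral_sq_mul_le (h : ConvLEWith C v₁ v₂ v) (hv₁ : IsWeight v₁) (hv₂ : IsWeight v₂)
    (hv : IsWeight v) {a b : V → ℝ≥0∞} (ha : AEMeasurable a) (hb : AEMeasurable b) :
    ∫⁻ ξ, (ENNReal.ofReal (v ξ) * ∫⁻ η, a η * b (ξ - η)) ^ 2 ≤
      C ^ 2 * ((∫⁻ ξ, (ENNReal.ofReal (v₁ ξ) * a ξ) ^ 2) *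
        ∫⁻ ξ, (ENNReal.ofReal (v₂ ξ) * b ξ) ^ 2) := by
  have measurable_mul {w : V → ℝ} (hw : IsWeight w) {c : V → ℝ≥0∞} (hc : AEMeasurable c) :
      AEMeasurable fun ξ => (ENNReal.ofReal (w ξ) * c ξ) ^ 2 :=
    (hw.measurable.ennreal_ofReal.aemeasurable.mul hc).pow_const 2
  rw [← lintegral_lintegral_mul_sub (measurable_mul hv₁ ha) (measurable_mul hv₂ hb),
    ← lintegral_const_mul' _ _ (by simp)]
  exact lintegral_mono fun ξ => h.sq_mul_lintegral_le hv₁ hv₂ hv ha hb ξ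

theorem hasSpectrum_mul (h : ConvLEWith C v₁ v₂ v) (hv₁ : IsWeight v₁) (hv₂ : IsWeight v₂)
    (hv : IsWeight v) (hg₁ : HasSpectrum v₁ g₁ G₁ M₁) (hg₂ : HasSpectrum v₂ g₂ G₂ M₂) :
    HasSpectrum v (g₁ * g₂) (G₁ ⋆[ContinuousLinearMap.mul ℂ ℂ] G₂) (C * M₁ * M₂) where
  integrable := hg₁.integrable.integrable_convolution _ hg₂.integrable
  eLpNorm_le := by
    have bound₁ := eLpNorm_two_le_iff.1 hg₁.eLpNorm_le
    have bound₂ := eLpNorm_two_le_iff.1 hg₂.eLpNorm_le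
    rw [eLpNorm_two_le_iff]
    simp_rw [hv₁.enorm_ofReal_mul, hv₂.enorm_ofReal_mul] at bound₁ bound₂
    calc ∫⁻ ξ, ‖(v ξ : ℂ) * (G₁ ⋆[ContinuousLinearMap.mul ℂ ℂ] G₂) ξ‖ₑ ^ 2
        ≤ ∫⁻ ξ, (ENNReal.ofReal (v ξ) * ∫⁻ η, ‖G₁ η‖ₑ * ‖G₂ (ξ - η)‖ₑ) ^ 2 := by
          refine lintegral_mono fun ξ => ?_
          simp only [hv.enorm_ofReal_mul, ← enorm_mul]
          gcongr
          exact enorm_integral_le_lintegral_enorm _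
      _ ≤ C ^ 2 * (_ * _) := h.lintegral_sq_mul_le hv₁ hv₂ hv
          hg₁.integrable.aestronglyMeasurable.enorm hg₂.integrable.aestronglyMeasurable.enorm
      _ ≤ C ^ 2 * (M₁ ^ 2 * M₂ ^ 2) := by gcongr
      _ = ((C * M₁ * M₂ : ℝ≥0) : ℝ≥0∞) ^ 2 := by push_cast; ring
  eq_fourierInv := by
    rw [fourierInv_convolution hg₁.integrable hg₂.integrable, hg₁.eq_fourierInv,
      hg₂.eq_fourierInv]

end ConvLEWith

namespace HasSpectrum

theorem of_norm_le (h : HasSpectrum v g G M) {H : V → ℂ} (hH : Integrable H) {c : ℝ≥0}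
    (hle : ∀ ξ, |v' ξ| * ‖H ξ‖ ≤ c * (|v ξ| * ‖G ξ‖)) : HasSpectrum v' (𝓕⁻ H) H (c * M) where
  integrable := hH
  eLpNorm_le := by
    rw [ENNReal.coe_mul]
    refine (eLpNorm_le_nnreal_smul_eLpNorm_of_ae_le_mul (ae_of_all _ fun ξ => ?_) _).trans
      (mul_le_mul_right h.eLpNorm_le _)
    simpa [← NNReal.coe_le_coe] using hle ξ
  eq_fourierInv := rfl

theorem indicator (h : HasSpectrum v g G M) {c : ℝ≥0} {E : Set V} (hE : MeasurableSet E)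
    (hle : ∀ ξ ∈ E, |v' ξ| ≤ c * |v ξ|) :
    HasSpectrum v' (𝓕⁻ (E.indicator G)) (E.indicator G) (c * M) := by
  refine h.of_norm_le (h.integrable.indicator hE) fun ξ => ?_
  by_cases hξ : ξ ∈ E
  · rw [Set.indicator_of_mem hξ, ← mul_assoc]
    exact mul_le_mul_of_nonneg_right (hle ξ hξ) (norm_nonneg _)
  · rw [Set.indicator_of_notMem hξ, norm_zero, mul_zero]
    positivity

theorem mono_weight (h : HasSpectrum v g G M) {c : ℝ≥0} (hle : ∀ ξ, |v' ξ| ≤ c * |v ξ|) :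
    HasSpectrum v' g G (c * M) := by
  simpa only [Set.indicator_univ, ← h.eq_fourierInv] using
    h.indicator MeasurableSet.univ fun ξ _ => hle ξ

theorem const_smul (h : HasSpectrum v g G M) (c : ℂ) :
    HasSpectrum v (c • g) (c • G) (‖c‖₊ * M) where
  integrable := h.integrable.smul c
  eLpNorm_le := by
    have rearrange : (fun ξ => (v ξ : ℂ) * (c • G) ξ) = c • fun ξ => (v ξ : ℂ) * G ξ := by
      ext ξ
      exact mul_left_comm _ _ _
    rw [rearrange, eLpNorm_const_smul, ENNReal.coe_mul]
    exact mul_le_mul_right h.eLpNorm_le _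
  eq_fourierInv := by rw [fourierInv_const_smul, h.eq_fourierInv]

theorem comp_sub (h : HasSpectrum v g G M) (y : V) :
    HasSpectrum v (fun x => g (x - y)) (fun ξ => Real.fourierChar (-inner ℝ ξ y) • G ξ) M where
  integrable := by
    simpa only [innerₗ_apply_apply] using! (Real.fourierIntegral_convergent_iff y).2 h.integrable
  eLpNorm_le := by
    refine le_of_eq_of_le (eLpNorm_congr_norm_ae (ae_of_all _ fun ξ => ?_)) h.eLpNorm_le
    rw [norm_mul, norm_mul, Circle.norm_smul]
  eq_fourierInv := by rw [h.eq_fourierInv, fourierInv_comp_sub]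

theorem add (hv : IsWeight v) (h₁ : HasSpectrum v g₁ G₁ M₁) (h₂ : HasSpectrum v g₂ G₂ M₂) :
    HasSpectrum v (g₁ + g₂) (G₁ + G₂) (M₁ + M₂) where
  integrable := h₁.integrable.add h₂.integrable
  eLpNorm_le := by
    have distrib : (fun ξ => (v ξ : ℂ) * (G₁ + G₂) ξ) =
        (fun ξ => (v ξ : ℂ) * G₁ ξ) + fun ξ => (v ξ : ℂ) * G₂ ξ := by
      ext ξ
      exact mul_add _ _ _
    rw [distrib, ENNReal.coe_add]
    exact (eLpNorm_add_le (hv.aestronglyMeasurable.mul h₁.integrable.aestronglyMeasurable)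
      (hv.aestronglyMeasurable.mul h₂.integrable.aestronglyMeasurable) one_le_two).trans
      (add_le_add h₁.eLpNorm_le h₂.eLpNorm_le)
  eq_fourierInv := by
    rw [fourierInv_add_of_integrable h₁.integrable h₂.integrable, h₁.eq_fourierInv,
      h₂.eq_fourierInv]

end HasSpectrum

namespace IsAlgebraWeight

theorem eLpNorm_one_le (hv : IsAlgebraWeight v C) (hG : AEStronglyMeasurable G volume)
    (hM : eLpNorm (fun ξ => (v ξ : ℂ) * G ξ) 2 volume ≤ M) :
    eLpNorm G 1 volume ≤ (C * M : ℝ≥0) := by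
  have factor : G = (fun ξ => (v ξ : ℂ)⁻¹) • fun ξ => (v ξ : ℂ) * G ξ := by
    ext ξ
    exact (inv_mul_cancel_left₀ (hv.ofReal_ne_zero ξ) (G ξ)).symm
  calc eLpNorm G 1 volume
      = eLpNorm ((fun ξ => (v ξ : ℂ)⁻¹) • fun ξ => (v ξ : ℂ) * G ξ) 1 volume := by
        rw [← factor]
    _ ≤ _ := eLpNorm_smul_le_mul_eLpNorm (p := 2) (q := 2) (r := 1)
        (hv.aestronglyMeasurable.mul hG) hv.aestronglyMeasurable.inv₀
    _ ≤ C * M := mul_le_mul' hv.eLpNorm_inv_le hM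
    _ = (C * M : ℝ≥0) := by push_cast; rfl

theorem integrable_of_eLpNorm_le (hv : IsAlgebraWeight v C) (hG : AEStronglyMeasurable G volume)
    (hM : eLpNorm (fun ξ => (v ξ : ℂ) * G ξ) 2 volume ≤ M) : Integrable G :=
  memLp_one_iff_integrable.1 ⟨hG, (hv.eLpNorm_one_le hG hM).trans_lt ENNReal.coe_lt_top⟩

/-- The functional `g ↦ g x` on `𝓑_v` is the pairing of `v ĝ` with an element of `L²`. -/
theorem exists_inner_eq_fourierInv (hv : IsAlgebraWeight v C) (x : V) :
    ∃ E : Lp ℂ 2 (volume : Measure V), ∀ (U : Lp ℂ 2 (volume : Measure V)) (H : V → ℂ),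
      U =ᵐ[volume] (fun ξ => (v ξ : ℂ) * H ξ) → inner ℂ E U = 𝓕⁻ H x := by
  let e ξ := (starRingEnd ℂ) ((Real.fourierChar (inner ℝ ξ x) : ℂ) * (v ξ : ℂ)⁻¹)
  have char_continuous : Continuous fun ξ : V => ((Real.fourierChar (inner ℝ ξ x) : Circle) : ℂ) :=
    continuous_subtype_val.comp (Real.continuous_fourierChar.comp (by fun_prop))
  have memLp_e : MemLp e 2 volume := by
    refine ⟨Complex.continuous_conj.comp_aestronglyMeasurable
      (char_continuous.aestronglyMeasurable.mul hv.aestronglyMeasurable.inv₀), ?_⟩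
    refine lt_of_eq_of_lt (eLpNorm_congr_norm_ae (ae_of_all _ fun ξ => ?_))
      (hv.eLpNorm_inv_le.trans_lt ENNReal.coe_lt_top)
    rw [RCLike.norm_conj, norm_mul, Circle.norm_coe, one_mul]
  refine ⟨memLp_e.toLp, fun U H hU => ?_⟩
  rw [L2.inner_def, Real.fourierInv_eq]
  refine integral_congr_ae ?_
  filter_upwards [hU, memLp_e.coeFn_toLp] with ξ hUξ heξ
  have := hv.ofReal_ne_zero ξ
  rw [hUξ, heξ]
  simp only [e, RCLike.inner_apply, Complex.conj_conj, Circle.smul_def, smul_eq_mul]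
  field_simp

end IsAlgebraWeight

namespace MemBall

theorem mono (h : MemBall v g M) (hM : M ≤ M') : MemBall v g M' :=
  h.imp fun _ hG => { hG with eLpNorm_le := hG.eLpNorm_le.trans (ENNReal.coe_le_coe.2 hM) }

theorem zero (v : V → ℝ) : MemBall v (0 : V → ℂ) 0 :=
  ⟨0, integrable_zero _ _ _, by simp, by ext x; simp [Real.fourierInv_eq]⟩

theorem mono_weight (h : MemBall v g M) {c : ℝ≥0} (hle : ∀ ξ, |v' ξ| ≤ c * |v ξ|) :
    MemBall v' g (c * M) :=
  h.imp fun _ hG => hG.mono_weight hle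

theorem const_smul (h : MemBall v g M) (c : ℂ) : MemBall v (c • g) (‖c‖₊ * M) :=
  h.elim fun _ hG => ⟨_, hG.const_smul c⟩

theorem comp_sub (h : MemBall v g M) (y : V) : MemBall v (fun x => g (x - y)) M :=
  h.elim fun _ hG => ⟨_, hG.comp_sub y⟩

theorem add (hv : IsWeight v) (h₁ : MemBall v g₁ M₁) (h₂ : MemBall v g₂ M₂) :
    MemBall v (g₁ + g₂) (M₁ + M₂) :=
  h₁.elim fun _ hG₁ => h₂.elim fun _ hG₂ => ⟨_, hG₁.add hv hG₂⟩

theorem mul (hv : IsAlgebraWeight v C) (h₁ : MemBall v g₁ M₁) (h₂ : MemBall v g₂ M₂) :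
    MemBall v (g₁ * g₂) (C * M₁ * M₂) :=
  h₁.elim fun _ hG₁ => h₂.elim fun _ hG₂ => ⟨_, hv.convLE.hasSpectrum_mul hv.toIsWeight
    hv.toIsWeight hv.toIsWeight hG₁ hG₂⟩

theorem norm_apply_le (hv : IsAlgebraWeight v C) (h : MemBall v g M) (x : V) :
    ‖g x‖ ≤ C * M := by
  obtain ⟨G, hG⟩ := h
  have hGm := hG.integrable.aestronglyMeasurable
  calc ‖g x‖ ≤ ∫ ξ, ‖G ξ‖ := by
        rw [hG.eq_fourierInv]; exact norm_fourierInv_le_integral_norm G x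
    _ = (eLpNorm G 1 volume).toReal := by
        rw [integral_norm_eq_lintegral_enorm hGm, eLpNorm_one_eq_lintegral_enorm]
    _ ≤ C * M := by
        simpa using ENNReal.toReal_mono ENNReal.coe_ne_top (hv.eLpNorm_one_le hGm hG.eLpNorm_le)

theorem continuous (h : MemBall v g M) : Continuous g := by
  obtain ⟨G, hG⟩ := h
  rw [hG.eq_fourierInv]
  exact continuous_fourierInv_of_integrable hG.integrable

/-- Completeness of `𝓑_v`, in the form of the convergence of absolutely convergent series. -/
theorem hasSum {ι : Type*} (hv : IsAlgebraWeight v C) {F : ι → V → ℂ} {K : ι → ℝ≥0}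
    (hF : ∀ i, MemBall v (F i) (K i)) (hK : Summable K)
    (hf : ∀ x, HasSum (fun i => F i x) (f x)) : MemBall v f (∑' i, K i) := by
  choose G hG using hF
  have memLp_mul i : MemLp (fun ξ => (v ξ : ℂ) * G i ξ) 2 volume :=
    ⟨hv.aestronglyMeasurable.mul (hG i).integrable.aestronglyMeasurable,
      (hG i).eLpNorm_le.trans_lt ENNReal.coe_lt_top⟩
  let L i : Lp ℂ 2 (volume : Measure V) := (memLp_mul i).toLp
  have norm_L_le i : ‖L i‖ ≤ K i := by
    rw [Lp.norm_toLp]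
    simpa using ENNReal.toReal_mono ENNReal.coe_ne_top (hG i).eLpNorm_le
  have summable_K : Summable fun i => (K i : ℝ) := NNReal.summable_coe.2 hK
  have hasSum_L : HasSum L (∑' i, L i) := (Summable.of_norm_bounded summable_K norm_L_le).hasSum
  set S := ∑' i, L i
  have norm_S_le : ‖S‖ ≤ (∑' i, K i : ℝ≥0) := by
    rw [NNReal.coe_tsum]
    exact tsum_of_norm_bounded summable_K.hasSum norm_L_le
  let H ξ := (v ξ : ℂ)⁻¹ * S ξ
  have mul_H : (fun ξ => (v ξ : ℂ) * H ξ) = S := by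
    ext ξ
    exact mul_inv_cancel_left₀ (hv.ofReal_ne_zero ξ) _
  have eLpNorm_le : eLpNorm (fun ξ => (v ξ : ℂ) * H ξ) 2 volume ≤ (∑' i, K i : ℝ≥0) := by
    rw [mul_H, ← ENNReal.toReal_le_toReal (Lp.eLpNorm_ne_top S) ENNReal.coe_ne_top, ← Lp.norm_def]
    exact norm_S_le
  refine ⟨H, hv.integrable_of_eLpNorm_le
    (hv.aestronglyMeasurable.inv₀.mul (Lp.aestronglyMeasurable S)) eLpNorm_le, eLpNorm_le, ?_⟩
  ext x
  obtain ⟨E, hE⟩ := hv.exists_inner_eq_fourierInv x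
  have hasSum_inner : HasSum (fun i => inner ℂ E (L i)) (inner ℂ E S) :=
    hasSum_L.mapL (innerSL ℂ E)
  rw [hE S H (by rw [mul_H])] at hasSum_inner
  refine (hf x).unique (hasSum_inner.congr_fun fun i => ?_)
  rw [hE (L i) (G i) (memLp_mul i).coeFn_toLp, (hG i).eq_fourierInv]

end MemBall

/-- Multiplication by `b` maps the balls of `𝓑_v` centred at the origin to balls, enlarging radii by
a factor at most `M`. Unlike the elements of `𝓑_v`, multipliers need not decay: `1` is one. -/
def IsMultiplier (v : V → ℝ) (b : V → ℂ) (M : ℝ≥0) : Prop :=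
  ∀ φ K, MemBall v φ K → MemBall v (φ * b) (K * M)

namespace IsMultiplier

variable {b b₁ b₂ : V → ℂ}

theorem mono (hb : IsMultiplier v b M) (hM : M ≤ M') : IsMultiplier v b M' := fun φ K hφ =>
  (hb φ K hφ).mono (by gcongr)

theorem zero (v : V → ℝ) : IsMultiplier v (0 : V → ℂ) 0 := fun φ K _ => by
  simpa using MemBall.zero v

theorem one (v : V → ℝ) : IsMultiplier v (1 : V → ℂ) 1 := fun φ K hφ => by simpa using hφ

theorem mul (h₁ : IsMultiplier v b₁ M₁) (h₂ : IsMultiplier v b₂ M₂) :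
    IsMultiplier v (b₁ * b₂) (M₁ * M₂) := fun φ K hφ => by
  simpa only [mul_assoc] using h₂ _ _ (h₁ _ _ hφ)

theorem pow (hb : IsMultiplier v b M) (m : ℕ) : IsMultiplier v (b ^ m) (M ^ m) := by
  induction m with
  | zero => simpa using one v
  | succ m ih => simpa only [pow_succ] using ih.mul hb

theorem prod {ι : Type*} (s : Finset ι) {b : ι → V → ℂ} {M : ι → ℝ≥0}
    (hb : ∀ i ∈ s, IsMultiplier v (b i) (M i)) :
    IsMultiplier v (∏ i ∈ s, b i) (∏ i ∈ s, M i) := by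
  classical
  induction s using Finset.induction_on with
  | empty => simpa using one v
  | insert i s hi ih =>
    rw [Finset.prod_insert hi, Finset.prod_insert hi]
    exact (hb i (Finset.mem_insert_self _ _)).mul
      (ih fun j hj => hb j (Finset.mem_insert_of_mem hj))

theorem const_smul (hb : IsMultiplier v b M) (c : ℂ) : IsMultiplier v (c • b) (‖c‖₊ * M) :=
  fun φ K hφ => by
    rw [mul_smul_comm, mul_left_comm]
    exact (hb φ K hφ).const_smul c

theorem add (hv : IsWeight v) (h₁ : IsMultiplier v b₁ M₁) (h₂ : IsMultiplier v b₂ M₂) :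
    IsMultiplier v (b₁ + b₂) (M₁ + M₂) := fun φ K hφ => by
  rw [mul_add, mul_add]
  exact (h₁ φ K hφ).add hv (h₂ φ K hφ)

theorem sum {ι : Type*} (hv : IsWeight v) (s : Finset ι) {b : ι → V → ℂ} {M : ι → ℝ≥0}
    (hb : ∀ i ∈ s, IsMultiplier v (b i) (M i)) :
    IsMultiplier v (∑ i ∈ s, b i) (∑ i ∈ s, M i) := by
  classical
  induction s using Finset.induction_on with
  | empty => simpa using zero v
  | insert i s hi ih =>
    rw [Finset.sum_insert hi, Finset.sum_insert hi]
    exact (hb i (Finset.mem_insert_self _ _)).add hv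
      (ih fun j hj => hb j (Finset.mem_insert_of_mem hj))

theorem add_pow (hv : IsWeight v) {A : ℕ → ℝ≥0} (hA : Monotone A) {s t : ℝ≥0}
    (h₁ : ∀ j, IsMultiplier v (b₁ ^ j) (A j * s ^ j)) (h₂ : IsMultiplier v b₂ t) (m : ℕ) :
    IsMultiplier v ((b₁ + b₂) ^ m) (A m * (s + t) ^ m) := by
  have binomial : (b₁ + b₂) ^ m =
      ∑ j ∈ Finset.range (m + 1), (m.choose j : ℂ) • (b₁ ^ j * b₂ ^ (m - j)) := by
    simp only [_root_.add_pow, Nat.cast_smul_eq_nsmul, nsmul_eq_mul, mul_comm]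
  rw [binomial]
  refine (sum hv _ fun j _ => ((h₁ j).mul (h₂.pow (m - j))).const_smul _).mono ?_
  rw [_root_.add_pow, Finset.mul_sum]
  refine Finset.sum_le_sum fun j hj => ?_
  have hjm : j ≤ m := Nat.lt_succ_iff.1 (Finset.mem_range.1 hj)
  calc ‖(m.choose j : ℂ)‖₊ * (A j * s ^ j * t ^ (m - j))
      = A j * (s ^ j * t ^ (m - j) * m.choose j) := by
        rw [← NNReal.coe_inj]
        push_cast
        rw [Complex.norm_natCast]
        ring
    _ ≤ _ := mul_le_mul_left (hA hjm) _

theorem of_memBall (hv : IsAlgebraWeight v C) (hb : MemBall v b M) : IsMultiplier v b (C * M) :=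
  fun φ K hφ => (hφ.mul hv hb).mono (by rw [mul_left_comm, mul_assoc])

end IsMultiplier

end WeightedSpaces

theorem inv_sq_mul_inv_sq_le_of_le_add {b b₁ b₂ p₁ p₂ q₁ q₂ v₁ v₂ : ℝ} (hb : 0 < b)
    (b_le : b ≤ b₁ + b₂) (hp₁ : 0 < p₁) (hp₂ : 0 < p₂) (hq₁ : 0 < q₁) (hq₂ : 0 < q₂)
    (hpv₁ : p₁ ≤ v₁) (hpv₂ : p₂ ≤ v₂) (hqv₁ : q₁ ≤ v₁) (hqv₂ : q₂ ≤ v₂) :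
    1 / v₁ ^ 2 * (1 / v₂ ^ 2) ≤
      2 / b ^ 2 * (1 / p₂ ^ 2 * (1 / (b₁⁻¹ * q₁) ^ 2) + 1 / p₁ ^ 2 * (1 / (b₂⁻¹ * q₂) ^ 2)) := by
  have b_sq_le : b ^ 2 ≤ 2 * (b₁ ^ 2 + b₂ ^ 2) :=
    (pow_le_pow_left₀ hb.le b_le 2).trans add_sq_le
  calc 1 / v₁ ^ 2 * (1 / v₂ ^ 2) = b ^ 2 / b ^ 2 * (1 / v₁ ^ 2 * (1 / v₂ ^ 2)) := by
        rw [div_self (by positivity), one_mul]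
    _ ≤ 2 * (b₁ ^ 2 + b₂ ^ 2) / b ^ 2 * (1 / v₁ ^ 2 * (1 / v₂ ^ 2)) := by gcongr
    _ = 2 / b ^ 2 * (b₁ ^ 2 * (1 / v₁ ^ 2 * (1 / v₂ ^ 2)) +
          b₂ ^ 2 * (1 / v₁ ^ 2 * (1 / v₂ ^ 2))) := by ring
    _ ≤ 2 / b ^ 2 * (b₁ ^ 2 * (1 / q₁ ^ 2 * (1 / p₂ ^ 2)) +
          b₂ ^ 2 * (1 / p₁ ^ 2 * (1 / q₂ ^ 2))) := by gcongr
    _ = _ := by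
        simp only [one_div, mul_pow, inv_pow, mul_inv, inv_inv]
        ring

namespace ConvLEWith

section Group

variable {G : Type*} [MeasureSpace G] [AddCommGroup G] {C D : ℝ≥0} {v v₁ v₂ v₁' v₂' p q : G → ℝ}

theorem mono (h : ConvLEWith C v₁ v₂ v) (hCD : C ≤ D) (pos₁ : ∀ ξ, 0 < v₁ ξ)
    (pos₂ : ∀ ξ, 0 < v₂ ξ) (le₁ : ∀ ξ, v₁ ξ ≤ v₁' ξ) (le₂ : ∀ ξ, v₂ ξ ≤ v₂' ξ) :
    ConvLEWith D v₁' v₂' v := fun ξ => by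
  have inv_sq_le {u u' : G → ℝ} (pos : ∀ ξ, 0 < u ξ) (le : ∀ ξ, u ξ ≤ u' ξ) (η : G) :
      ENNReal.ofReal (1 / u' η ^ 2) ≤ ENNReal.ofReal (1 / u η ^ 2) :=
    ENNReal.ofReal_le_ofReal
      (one_div_le_one_div_of_le (pow_pos (pos η) 2) (pow_le_pow_left₀ (pos η).le (le η) 2))
  calc _ ≤ _ := lintegral_mono fun η => mul_le_mul' (inv_sq_le pos₁ le₁ η) (inv_sq_le pos₂ le₂ _)
    _ ≤ ENNReal.ofReal (C ^ 2 / v ξ ^ 2) := h ξ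
    _ ≤ ENNReal.ofReal (D ^ 2 / v ξ ^ 2) := by gcongr

theorem const_mul (h : ConvLEWith C v₁ v₂ v) {l : ℝ} (hl : 0 < l) :
    ConvLEWith C v₁ (fun ξ => l * v₂ ξ) (fun ξ => l * v ξ) := fun ξ => by
  have scale (x y : ℝ) : ENNReal.ofReal (x / (l * y) ^ 2) =
      ENNReal.ofReal (1 / l ^ 2) * ENNReal.ofReal (x / y ^ 2) := by
    rw [← ENNReal.ofReal_mul (by positivity), mul_pow, div_mul_div_comm, one_mul]
  simp_rw [scale, mul_left_comm _ (ENNReal.ofReal (1 / l ^ 2))]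
  rw [lintegral_const_mul' _ _ ENNReal.ofReal_ne_top]
  exact mul_le_mul_right (h ξ) _

theorem add (hp : ConvLEWith C v v p) (hq : ConvLEWith D v v q) (p_pos : ∀ ξ, 0 < p ξ)
    (q_pos : ∀ ξ, 0 < q ξ) : ConvLEWith (2 * (C + D)) v v (fun ξ => p ξ + q ξ) := fun ξ => by
  have rescale {B : ℝ≥0} {r s : ℝ} (hr : 0 < r) (hs : 0 < s) (hsr : s ≤ 2 * r) :
      ENNReal.ofReal (B ^ 2 / r ^ 2) ≤ ENNReal.ofReal ((2 * B) ^ 2 / s ^ 2) := by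
    rw [← mul_div_mul_left ((B : ℝ) ^ 2) _ (pow_ne_zero 2 two_ne_zero), ← mul_pow, ← mul_pow]
    gcongr
  have sum_pos : 0 < p ξ + q ξ := add_pos (p_pos ξ) (q_pos ξ)
  rcases le_total (p ξ) (q ξ) with hle | hle
  · refine (hq ξ).trans ((rescale (q_pos ξ) sum_pos (by linarith)).trans ?_)
    gcongr
    push_cast
    linarith [C.coe_nonneg]
  · refine (hp ξ).trans ((rescale (p_pos ξ) sum_pos (by linarith)).trans ?_)
    gcongr
    push_cast
    linarith [D.coe_nonneg]

variable [MeasurableAdd₂ G] [MeasurableNeg G] [(volume : Measure G).IsAddLeftInvariant]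
  [(volume : Measure G).IsNegInvariant]

/-- By subadditivity a factor `b ξ` can be moved to one of the two variables `η` and `ξ - η`, and
their roles are then exchanged by the substitution `η ↦ ξ - η`. -/
theorem of_subadditive {b : G → ℝ} (h : ConvLEWith C p (b⁻¹ * q) (b⁻¹ * q)) (hp : IsWeight p)
    (hq : IsWeight q) (hb : IsWeight b) (b_add : ∀ ξ η, b (ξ + η) ≤ b ξ + b η)
    (p_le : ∀ ξ, p ξ ≤ v ξ) (q_le : ∀ ξ, q ξ ≤ v ξ) : ConvLEWith (2 * C) v v q := fun ξ => by
  let F η := ENNReal.ofReal (1 / p η ^ 2) * ENNReal.ofReal (1 / (b⁻¹ * q) (ξ - η) ^ 2)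
  have measurable_F : Measurable F :=
    ((hp.measurable.pow_const 2).const_div 1).ennreal_ofReal.mul
      ((((hb.measurable.inv.mul hq.measurable).pow_const 2).const_div 1).ennreal_ofReal.comp
        (measurable_id.const_sub ξ))
  have integrand_le η : ENNReal.ofReal (1 / v η ^ 2) * ENNReal.ofReal (1 / v (ξ - η) ^ 2) ≤
      ENNReal.ofReal (2 / b ξ ^ 2) * (F (ξ - η) + F η) := by
    simp only [F, sub_sub_cancel, Pi.mul_apply, Pi.inv_apply]
    rw [← ENNReal.ofReal_mul (by positivity), ← ENNReal.ofReal_mul (by positivity),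
      ← ENNReal.ofReal_mul (by positivity), ← ENNReal.ofReal_add (by positivity) (by positivity),
      ← ENNReal.ofReal_mul (by positivity)]
    exact ENNReal.ofReal_le_ofReal <| inv_sq_mul_inv_sq_le_of_le_add (hb.pos ξ)
      (by simpa using b_add η (ξ - η)) (hp.pos _) (hp.pos _) (hq.pos _) (hq.pos _) (p_le _)
      (p_le _) (q_le _) (q_le _)
  have integral_F_le : ∫⁻ η, F η ≤ ENNReal.ofReal (C ^ 2 / (b⁻¹ * q) ξ ^ 2) := h ξ
  calc _ ≤ ∫⁻ η, ENNReal.ofReal (2 / b ξ ^ 2) * (F (ξ - η) + F η) := lintegral_mono integrand_le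
    _ = ENNReal.ofReal (2 / b ξ ^ 2) * ((∫⁻ η, F η) + ∫⁻ η, F η) := by
        rw [lintegral_const_mul' _ _ ENNReal.ofReal_ne_top, lintegral_add_right _ measurable_F,
          lintegral_sub_left_eq_self F ξ]
    _ ≤ ENNReal.ofReal (2 / b ξ ^ 2) * (ENNReal.ofReal (C ^ 2 / (b⁻¹ * q) ξ ^ 2) +
          ENNReal.ofReal (C ^ 2 / (b⁻¹ * q) ξ ^ 2)) := by gcongr
    _ = ENNReal.ofReal ((2 * C : ℝ≥0) ^ 2 / q ξ ^ 2) := by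
        have := hb.pos ξ
        have := hq.pos ξ
        rw [← ENNReal.ofReal_add (by positivity) (by positivity),
          ← ENNReal.ofReal_mul (by positivity)]
        congr 1
        simp only [Pi.mul_apply, Pi.inv_apply]
        push_cast
        field_simp
        ring

end Group

end ConvLEWith

section Decay

open Filter Topology

variable {V : Type*} [NormedAddCommGroup V] [MeasurableSpace V]

theorem tendsto_cocompact_zero_of_integrable [BorelSpace V] [ProperSpace V] {μ : Measure V}
    [μ.IsAddHaarMeasure] {f : V → ℝ} (hf : Integrable f μ) (nonneg : ∀ ξ, 0 ≤ f ξ) {A : ℝ}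
    (hA : ∀ ξ η, dist η ξ < 1 → f ξ ≤ A * f η) : Tendsto f (cocompact V) (𝓝 0) := by
  have volume_pos : 0 < μ.real (Metric.ball 0 1) :=
    ENNReal.toReal_pos (Metric.measure_ball_pos μ 0 one_pos).ne' measure_ball_lt_top.ne
  have small : ∀ ε > 0, ∀ᶠ ξ in cocompact V, f ξ * μ.real (Metric.ball 0 1) ≤ |A| * ε := by
    intro ε hε
    obtain ⟨g, hg, hfg, -, integrable_g⟩ := hf.exists_hasCompactSupport_integral_sub_le hε
    filter_upwards [hg.isCompact.cthickening (r := 1) |>.compl_mem_cocompact] with ξ hξ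
    have g_eq_zero {η} (hη : η ∈ Metric.ball ξ 1) : g η = 0 := by
      by_contra hgη
      refine hξ (Metric.mem_cthickening_of_dist_le ξ η 1 _ (subset_tsupport g hgη) ?_)
      rw [dist_comm]
      exact (Metric.mem_ball.1 hη).le
    calc f ξ * μ.real (Metric.ball 0 1) = ∫ _ in Metric.ball ξ 1, f ξ ∂μ := by
          rw [setIntegral_const, smul_eq_mul, mul_comm, measureReal_def, measureReal_def,
            Measure.addHaar_ball_center μ ξ]
      _ ≤ ∫ η in Metric.ball ξ 1, |A| * ‖f η - g η‖ ∂μ := by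
          refine setIntegral_mono_on (integrableOn_const measure_ball_lt_top.ne)
            ((hf.sub integrable_g).norm.const_mul _).integrableOn measurableSet_ball fun η hη => ?_
          rw [g_eq_zero hη, sub_zero, Real.norm_of_nonneg (nonneg η)]
          exact (hA ξ η hη).trans (mul_le_mul_of_nonneg_right (le_abs_self A) (nonneg η))
      _ ≤ ∫ η, |A| * ‖f η - g η‖ ∂μ :=
          setIntegral_le_integral ((hf.sub integrable_g).norm.const_mul _)
            (ae_of_all _ fun η => by positivity)
      _ ≤ |A| * ε := by
          rw [integral_const_mul]
          gcongr
  refine tendsto_order.2 ⟨fun a ha => Eventually.of_forall fun ξ => ha.trans_le (nonneg ξ),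
    fun a ha => ?_⟩
  filter_upwards [small (a * μ.real (Metric.ball 0 1) / (|A| + 1)) (by positivity)] with ξ hξ
  have ratio_lt : |A| / (|A| + 1) < 1 := (div_lt_one (by positivity)).2 (lt_add_one _)
  refine lt_of_mul_lt_mul_right (hξ.trans_lt ?_) volume_pos.le
  calc |A| * (a * μ.real (Metric.ball 0 1) / (|A| + 1))
      = |A| / (|A| + 1) * (a * μ.real (Metric.ball 0 1)) := by ring
    _ < a * μ.real (Metric.ball 0 1) := mul_lt_of_lt_one_left (by positivity) ratio_lt

/-- A weight of polynomial growth: the condition defining `Kpol`, on an arbitrary normed space and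
with `1 + ‖ξ‖` and a natural exponent in place of `⟨ξ⟩` and a real one. -/
structure IsModerate (w : V → ℝ) : Prop extends IsWeight w where
  exists_le_mul : ∃ (A : ℝ) (N : ℕ), 0 < A ∧ ∀ ξ η, w (ξ + η) ≤ A * (1 + ‖ξ‖) ^ N * w η

namespace IsModerate

variable {w : V → ℝ} {δ : ℝ}

theorem exists_le_mul_one_add_norm_pow (hw : IsModerate w) :
    ∃ (P : ℝ≥0) (N : ℕ), ∀ ξ, w ξ ≤ P * (1 + ‖ξ‖) ^ N := by
  obtain ⟨A, N, hA, growth⟩ := hw.exists_le_mul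
  refine ⟨⟨A * w 0, (mul_pos hA (hw.pos 0)).le⟩, N, fun ξ => ?_⟩
  have := growth ξ 0
  rwa [add_zero, mul_right_comm] at this

theorem tendsto_atTop [BorelSpace V] [ProperSpace V] {μ : Measure V} [μ.IsAddHaarMeasure]
    (hw : IsModerate w) (hδ : 0 < δ) (hint : MemLp (fun ξ => w ξ ^ (-δ)) 2 μ) :
    Tendsto w (cocompact V) atTop := by
  obtain ⟨A, N, hA, growth⟩ := hw.exists_le_mul
  have rpow_pos ξ : 0 < (w ξ ^ (-δ)) ^ 2 := pow_pos (Real.rpow_pos_of_pos (hw.pos ξ) _) 2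
  have local_growth ξ η (hη : dist η ξ < 1) : w η ≤ A * 2 ^ N * w ξ := by
    have := hw.pos ξ
    rw [dist_eq_norm] at hη
    calc w η ≤ A * (1 + ‖η - ξ‖) ^ N * w ξ := by simpa using growth (η - ξ) ξ
      _ ≤ A * 2 ^ N * w ξ := by gcongr; linarith
  have local_rpow_le ξ η (hη : dist η ξ < 1) :
      (w ξ ^ (-δ)) ^ 2 ≤ ((A * 2 ^ N) ^ δ) ^ 2 * (w η ^ (-δ)) ^ 2 := by
    have hξ := hw.pos ξ
    rw [← mul_pow]
    refine pow_le_pow_left₀ (by positivity) ?_ 2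
    calc w ξ ^ (-δ) = (A * 2 ^ N) ^ δ * (A * 2 ^ N * w ξ) ^ (-δ) := by
          rw [Real.mul_rpow (by positivity) hξ.le, Real.rpow_neg (by positivity : 0 ≤ A * 2 ^ N),
            mul_inv_cancel_left₀ (by positivity)]
      _ ≤ (A * 2 ^ N) ^ δ * w η ^ (-δ) := by
          gcongr ?_ * ?_
          exact Real.rpow_le_rpow_of_nonpos (hw.pos η) (local_growth ξ η hη) (neg_nonpos.2 hδ.le)
  have tendsto_zero : Tendsto (fun ξ => (w ξ ^ (-δ)) ^ 2) (cocompact V) (𝓝[>] 0) :=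
    tendsto_nhdsWithin_iff.2 ⟨tendsto_cocompact_zero_of_integrable hint.integrable_sq
      (fun ξ => (rpow_pos ξ).le) local_rpow_le, Eventually.of_forall rpow_pos⟩
  refine ((tendsto_rpow_neg_nhdsGT_zero
    (neg_neg_of_pos (inv_pos.2 (mul_pos two_pos hδ)))).comp tendsto_zero).congr fun ξ => ?_
  rw [Function.comp_apply, ← Real.rpow_natCast, ← Real.rpow_mul (hw.pos ξ).le,
    ← Real.rpow_mul (hw.pos ξ).le, Nat.cast_ofNat]
  field_simp
  exact Real.rpow_one _

theorem exists_le_of_tendsto (hw : IsModerate w) (hlim : Tendsto w (cocompact V) atTop) :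
    ∃ c > 0, ∀ ξ, c ≤ w ξ := by
  obtain ⟨A, N, hA, growth⟩ := hw.exists_le_mul
  obtain ⟨K, hK, one_le⟩ := mem_cocompact.1 (hlim.eventually_ge_atTop 1)
  obtain ⟨R, hR⟩ := hK.isBounded.exists_norm_le
  have w_zero := hw.pos 0
  refine ⟨min 1 (w 0 / (A * (1 + |R|) ^ N)), by positivity, fun ξ => ?_⟩
  by_cases hξ : ξ ∈ K
  · have := hw.pos ξ
    refine (min_le_right _ _).trans ((div_le_iff₀ (by positivity)).2 ?_)
    calc w 0 ≤ A * (1 + ‖ξ‖) ^ N * w ξ := by simpa using growth (-ξ) ξ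
      _ ≤ w ξ * (A * (1 + |R|) ^ N) := by
        rw [mul_comm]
        gcongr
        exact (hR ξ hξ).trans (le_abs_self R)
  · exact (min_le_left _ _).trans (one_le hξ)

end IsModerate

end Decay

theorem rpow_le_rpow_sub_one_mul {x c δ : ℝ} (hc : 0 < c) (hδ : δ ≤ 1) (hx : c ≤ x) :
    x ^ δ ≤ c ^ (δ - 1) * x := by
  have x_pos := hc.trans_le hx
  calc x ^ δ = x ^ (δ - 1) * x := by rw [← Real.rpow_add_one x_pos.ne', sub_add_cancel]
    _ ≤ c ^ (δ - 1) * x := by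
      gcongr ?_ * _
      exact Real.rpow_le_rpow_of_nonpos hc hx (sub_nonpos.2 hδ)

section WienerLevyWeight

open Filter

variable {V : Type*} [NormedAddCommGroup V] [InnerProductSpace ℝ V] [FiniteDimensional ℝ V]
  [MeasurableSpace V] [BorelSpace V]

/-- The weights of the class `KWL`, on an arbitrary Euclidean space. Of the function `⟨·⟩` only the
subadditivity is retained. -/
structure IsWienerLevyWeight (w : V → ℝ) (δ : ℝ) : Prop extends IsModerate w where
  delta_pos : 0 < δ
  delta_lt_one : δ < 1
  memLp : MemLp (fun ξ => w ξ ^ (-δ)) 2 volume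
  exists_convLE : ∃ C, ConvLEWith C w w w
  exists_convLE_rpow : ∃ C, ConvLEWith C (fun ξ => w ξ ^ δ) (fun ξ => w ξ ^ δ) (fun ξ => w ξ ^ δ)
  exists_convLE_inv_mul : ∃ C, ∃ b : V → ℝ, IsWeight b ∧ (∀ ξ η, b (ξ + η) ≤ b ξ + b η) ∧
    ConvLEWith C (fun ξ => w ξ ^ δ) (b⁻¹ * w) (b⁻¹ * w)

namespace IsWienerLevyWeight

variable {w : V → ℝ} {δ : ℝ}

theorem isWeight_rpow (hw : IsWienerLevyWeight w δ) : IsWeight fun ξ => w ξ ^ δ :=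
  ⟨hw.measurable.pow_const δ, fun ξ => Real.rpow_pos_of_pos (hw.pos ξ) δ⟩

theorem tendsto_atTop (hw : IsWienerLevyWeight w δ) : Tendsto w (cocompact V) atTop :=
  hw.toIsModerate.tendsto_atTop hw.delta_pos hw.memLp

theorem exists_rpow_le_mul (hw : IsWienerLevyWeight w δ) : ∃ B > 0, ∀ ξ, w ξ ^ δ ≤ B * w ξ := by
  obtain ⟨c, hc, hle⟩ := hw.toIsModerate.exists_le_of_tendsto hw.tendsto_atTop
  exact ⟨c ^ (δ - 1), by positivity,
    fun ξ => rpow_le_rpow_sub_one_mul hc hw.delta_lt_one.le (hle ξ)⟩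

theorem eventually_rpow_le_mul (hw : IsWienerLevyWeight w δ) {ε : ℝ} (hε : 0 < ε) :
    ∀ᶠ ξ in cocompact V, w ξ ^ δ ≤ ε * w ξ := by
  filter_upwards [hw.tendsto_atTop.eventually_ge_atTop (ε ^ (δ - 1)⁻¹)] with ξ hξ
  have := rpow_le_rpow_sub_one_mul (by positivity) hw.delta_lt_one.le hξ
  rwa [← Real.rpow_mul hε.le, inv_mul_cancel₀ (sub_ne_zero.2 hw.delta_lt_one.ne),
    Real.rpow_one] at this

theorem exists_eLpNorm_inv_le (hw : IsWienerLevyWeight w δ) : ∃ K : ℝ≥0, ∀ v : V → ℝ,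
    (∀ ξ, w ξ ^ δ ≤ v ξ) → eLpNorm (fun ξ => (v ξ : ℂ)⁻¹) 2 volume ≤ K := by
  refine ⟨(eLpNorm (fun ξ => w ξ ^ (-δ)) 2 volume).toNNReal, fun v hv => ?_⟩
  rw [ENNReal.coe_toNNReal hw.memLp.2.ne]
  refine eLpNorm_mono fun ξ => ?_
  have rpow_pos := hw.isWeight_rpow.pos ξ
  rw [Real.rpow_neg (hw.pos ξ).le, norm_inv, norm_inv, Complex.norm_real,
    Real.norm_of_nonneg rpow_pos.le, Real.norm_of_nonneg (rpow_pos.le.trans (hv ξ))]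
  exact inv_anti₀ rpow_pos (hv ξ)

theorem exists_isAlgebraWeight (hw : IsWienerLevyWeight w δ) : ∃ K, IsAlgebraWeight w K := by
  obtain ⟨B, hB, rpow_le⟩ := hw.exists_rpow_le_mul
  obtain ⟨K, eLpNorm_inv_le⟩ := hw.exists_eLpNorm_inv_le
  obtain ⟨C, hC⟩ := hw.exists_convLE
  have scale : (fun ξ => (w ξ : ℂ)⁻¹) = (B : ℂ) • fun ξ => ((B * w ξ : ℝ) : ℂ)⁻¹ := by
    ext ξ
    rw [Pi.smul_apply, smul_eq_mul, Complex.ofReal_mul, mul_inv,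
      mul_inv_cancel_left₀ (Complex.ofReal_ne_zero.2 hB.ne')]
  refine ⟨‖(B : ℂ)‖₊ * K + C, hw.toIsWeight, ?_,
    hC.mono le_add_self hw.pos hw.pos (fun _ => le_rfl) fun _ => le_rfl⟩
  rw [scale, eLpNorm_const_smul]
  exact (mul_le_mul_right (eLpNorm_inv_le _ rpow_le) _).trans
    (ENNReal.coe_le_coe.2 (le_self_add (a := ‖(B : ℂ)‖₊ * K)))

theorem exists_isAlgebraWeight_add (hw : IsWienerLevyWeight w δ) : ∃ K : ℝ≥0, ∀ l : ℝ, 0 < l →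
    IsAlgebraWeight (fun ξ => w ξ ^ δ + l * w ξ) K := by
  obtain ⟨K, eLpNorm_inv_le⟩ := hw.exists_eLpNorm_inv_le
  obtain ⟨C, hC⟩ := hw.exists_convLE_rpow
  obtain ⟨D, b, hb, b_add, hD⟩ := hw.exists_convLE_inv_mul
  refine ⟨K + 2 * (C + 2 * D), fun l hl => ?_⟩
  have rpow_pos := hw.isWeight_rpow.pos
  have isWeight_mul : IsWeight fun ξ => l * w ξ :=
    ⟨hw.measurable.const_mul l, fun ξ => mul_pos hl (hw.pos ξ)⟩
  let v ξ := w ξ ^ δ + l * w ξ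
  have rpow_le ξ : w ξ ^ δ ≤ v ξ := le_add_of_nonneg_right (isWeight_mul.pos ξ).le
  have mul_le ξ : l * w ξ ≤ v ξ := le_add_of_nonneg_left (rpow_pos ξ).le
  have isWeight_v : IsWeight v := ⟨hw.isWeight_rpow.measurable.add isWeight_mul.measurable,
    fun ξ => add_pos (rpow_pos ξ) (isWeight_mul.pos ξ)⟩
  have conv_rpow : ConvLEWith C v v fun ξ => w ξ ^ δ :=
    hC.mono le_rfl rpow_pos rpow_pos rpow_le rpow_le
  have scale : (fun ξ => l * (b⁻¹ * w) ξ) = b⁻¹ * fun ξ => l * w ξ := by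
    ext ξ
    exact mul_left_comm _ _ _
  have conv_mul : ConvLEWith (2 * D) v v fun ξ => l * w ξ := by
    have := hD.const_mul hl
    rw [scale] at this
    exact this.of_subadditive hw.isWeight_rpow isWeight_mul hb b_add rpow_le mul_le
  exact ⟨isWeight_v, (eLpNorm_inv_le v rpow_le).trans (by exact_mod_cast le_self_add),
    (conv_rpow.add conv_mul rpow_pos isWeight_mul.pos).mono le_add_self isWeight_v.pos
      isWeight_v.pos (fun _ => le_rfl) fun _ => le_rfl⟩

end IsWienerLevyWeight

end WienerLevyWeight

section Plancherel

variable {V : Type*} [NormedAddCommGroup V] [InnerProductSpace ℝ V] [FiniteDimensional ℝ V]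
  [MeasurableSpace V] [BorelSpace V] {f g G : V → ℂ}

theorem integral_fourierInv_mul_eq (hf : Integrable f) (hg : Integrable g) :
    ∫ ξ, 𝓕⁻ f ξ * g ξ = ∫ x, f x * 𝓕⁻ g x := by
  have flip_eq : (-innerₗ V).flip = -innerₗ V := by
    ext x y
    simp [real_inner_comm]
  have exchange := VectorFourier.integral_fourierIntegral_smul_eq_flip (L := -innerₗ V)
    Real.continuous_fourierChar continuous_inner.neg hf hg
  rwa [flip_eq] at exchange

theorem coeFn_fourierInv_toLp (h1 : Integrable G) (h2 : MemLp G 2 volume) :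
    ((𝓕⁻ h2.toLp : Lp ℂ 2 (volume : Measure V)) : V → ℂ) =ᵐ[volume] 𝓕⁻ G := by
  refine ae_eq_of_integral_contDiff_smul_eq ((Lp.memLp _).locallyIntegrable one_le_two)
    (continuous_fourierInv_of_integrable h1).locallyIntegrable fun θ hθ θ_supp => ?_
  let φ : 𝓢(V, ℂ) := (θ_supp.comp_left (g := fun t : ℝ => (t : ℂ)) rfl).toSchwartzMap
    (Complex.ofRealCLM.contDiff.comp hθ)
  have smul_eq (H : V → ℂ) : ∫ x, θ x • H x = ∫ x, φ x • H x := rfl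
  have tempered := congrArg (fun T : 𝓢'(V, ℂ) => T φ)
    (Lp.fourierInv_toTemperedDistribution_eq h2.toLp)
  simp only [TemperedDistribution.fourierInv_apply, Lp.toTemperedDistribution_apply] at tempered
  calc ∫ x, θ x • (𝓕⁻ h2.toLp : Lp ℂ 2 (volume : Measure V)) x
      = ∫ x, (𝓕⁻ φ) x • (h2.toLp : V → ℂ) x := by rw [smul_eq]; exact tempered.symm
    _ = ∫ x, 𝓕⁻ (φ : V → ℂ) x * G x := by
        refine integral_congr_ae ?_
        filter_upwards [h2.coeFn_toLp] with x hx
        rw [hx, SchwartzMap.fourierInv_coe, smul_eq_mul]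
    _ = ∫ x, θ x • 𝓕⁻ G x := by rw [integral_fourierInv_mul_eq φ.integrable h1, smul_eq]; rfl

theorem eLpNorm_fourierInv (h1 : Integrable G) (h2 : MemLp G 2 volume) :
    eLpNorm (𝓕⁻ G) 2 volume = eLpNorm G 2 volume := by
  have isometry : ‖(𝓕⁻ h2.toLp : Lp ℂ 2 (volume : Measure V))‖ = ‖h2.toLp‖ :=
    (Lp.fourierTransformₗᵢ V ℂ).symm.norm_map _
  rw [Lp.norm_def, Lp.norm_def,
    ENNReal.toReal_eq_toReal_iff' (Lp.eLpNorm_ne_top _) (Lp.eLpNorm_ne_top _)] at isometry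
  rw [← eLpNorm_congr_ae (coeFn_fourierInv_toLp h1 h2), isometry, eLpNorm_congr_ae h2.coeFn_toLp]

end Plancherel

theorem eLpNorm_pow_succ_le {X : Type*} [MeasurableSpace X] {μ : Measure X} {f : X → ℂ} {s : ℝ≥0}
    (hf : ∀ x, ‖f x‖ ≤ s) (p : ℝ≥0∞) (j : ℕ) :
    eLpNorm (f ^ (j + 1)) p μ ≤ s ^ j * eLpNorm f p μ := by
  rw [← ENNReal.coe_pow]
  refine eLpNorm_le_nnreal_smul_eLpNorm_of_ae_le_mul (ae_of_all _ fun x => ?_) _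
  rw [Pi.pow_apply, nnnorm_pow, pow_succ]
  gcongr
  exact hf x

open Filter Asymptotics in
theorem exists_one_add_mul_pow_mul_pow_le (R : ℝ≥0) (N : ℕ) {r s : ℝ≥0} (hrs : r < s) :
    ∃ D : ℝ≥0, ∀ m : ℕ, (1 + m * R) ^ N * r ^ m ≤ D * s ^ m := by
  have affine : (fun m : ℕ => 1 + (m : ℝ) * R) =O[atTop] fun m : ℕ => (m : ℝ) := by
    refine IsBigO.of_bound (1 + R) ?_
    filter_upwards [eventually_ge_atTop 1] with m hm
    have one_le : (1 : ℝ) ≤ m := by exact_mod_cast hm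
    rw [Real.norm_of_nonneg (by positivity), Real.norm_natCast, add_mul, one_mul, mul_comm (R : ℝ)]
    gcongr
  have poly_geom : (fun m : ℕ => (1 + (m : ℝ) * R) ^ N * (r : ℝ) ^ m) =O[atTop]
      fun m : ℕ => (s : ℝ) ^ m :=
    ((affine.pow N).mul (isBigO_refl _ _)).trans
      (isLittleO_pow_const_mul_const_pow_const_pow_of_norm_lt N (by simpa using hrs)).isBigO
  obtain ⟨D, hD, bound⟩ := bound_of_isBigO_nat_atTop poly_geom
  refine ⟨⟨D, hD.le⟩, fun m => ?_⟩
  have s_pos : (0 : ℝ) < s := by exact_mod_cast (zero_le (a := r)).trans_lt hrs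
  have bound_m := bound (pow_pos s_pos m).ne'
  rw [Real.norm_of_nonneg (by positivity), Real.norm_of_nonneg (by positivity)] at bound_m
  exact_mod_cast bound_m

section SpectralRadius

variable {V : Type*} [NormedAddCommGroup V] [InnerProductSpace ℝ V] [FiniteDimensional ℝ V]
  [MeasurableSpace V] [BorelSpace V] {v w : V → ℝ} {C M c P s : ℝ≥0} {R : ℝ} {N : ℕ}
  {a g G : V → ℂ}

namespace HasSpectrum

theorem eLpNorm_two_le (h : HasSpectrum v g G M) (hc : ∀ ξ, 1 ≤ c * |v ξ|) :
    eLpNorm G 2 volume ≤ (c * M : ℝ≥0) := by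
  simpa using (h.of_norm_le (v' := fun _ => 1) h.integrable fun ξ => by
    rw [abs_one, one_mul, ← mul_assoc]
    exact le_mul_of_one_le_left (norm_nonneg _) (hc ξ)).eLpNorm_le

theorem memLp_two (h : HasSpectrum v g G M) (hc : ∀ ξ, 1 ≤ c * |v ξ|) : MemLp G 2 volume :=
  ⟨h.integrable.aestronglyMeasurable, (h.eLpNorm_two_le hc).trans_lt ENNReal.coe_lt_top⟩

theorem eLpNorm_two_eq (h : HasSpectrum v g G M) (hc : ∀ ξ, 1 ≤ c * |v ξ|) :
    eLpNorm G 2 volume = eLpNorm g 2 volume := by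
  rw [h.eq_fourierInv, eLpNorm_fourierInv h.integrable (h.memLp_two hc)]

theorem exists_pow_support_subset (hv : IsAlgebraWeight v C) (ha : HasSpectrum v a G M)
    (hG : G.support ⊆ Metric.closedBall 0 R) (hR : 0 ≤ R) (j : ℕ) :
    ∃ Gj Mj, HasSpectrum v (a ^ (j + 1)) Gj Mj ∧
      Gj.support ⊆ Metric.closedBall 0 ((j + 1) * R) := by
  induction j with
  | zero => exact ⟨G, M, by simpa using ha, by simpa using hG⟩
  | succ j ih =>
    obtain ⟨Gj, Mj, hGj, support_Gj⟩ := ih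
    refine ⟨_, _, by
      rw [pow_succ]
      exact hv.convLE.hasSpectrum_mul hv.toIsWeight hv.toIsWeight hv.toIsWeight hGj ha, ?_⟩
    refine (support_convolution_subset _).trans ((Set.add_subset_add support_Gj hG).trans ?_)
    rw [closedBall_add_closedBall (by positivity) hR, add_zero]
    refine Metric.closedBall_subset_closedBall (le_of_eq ?_)
    push_cast
    ring

/-- Plancherel's identity turns the bound on `‖a ^ (j + 1)‖_{L²}` into one on the spectrum, and on
a ball of radius `(j + 1) R` the weight costs only a polynomial factor. -/
theorem memBall_pow_of_support_subset (hv : IsAlgebraWeight v C) (hc : ∀ ξ, 1 ≤ c * |v ξ|)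
    (growth : ∀ ξ, v ξ ≤ P * (1 + ‖ξ‖) ^ N) {R : ℝ≥0} (ha : HasSpectrum v a G M)
    (hG : G.support ⊆ Metric.closedBall 0 R) (hs : ∀ x, ‖a x‖ ≤ s) (j : ℕ) :
    MemBall v (a ^ (j + 1)) (P * (1 + (j + 1) * R) ^ N * (s ^ j * (c * M))) := by
  obtain ⟨Gj, Mj, hGj, support_Gj⟩ := ha.exists_pow_support_subset hv hG R.coe_nonneg j
  have flat : HasSpectrum (fun _ => 1) (a ^ (j + 1)) Gj (s ^ j * (c * M)) := by
    refine ⟨hGj.integrable, ?_, hGj.eq_fourierInv⟩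
    calc eLpNorm (fun ξ => ((1 : ℝ) : ℂ) * Gj ξ) 2 volume
        = eLpNorm (a ^ (j + 1)) 2 volume := by
          simp only [Complex.ofReal_one, one_mul, hGj.eLpNorm_two_eq hc]
      _ ≤ s ^ j * eLpNorm a 2 volume := eLpNorm_pow_succ_le hs 2 j
      _ ≤ s ^ j * (c * M : ℝ≥0) := by
          gcongr
          exact (ha.eLpNorm_two_eq hc).symm.trans_le (ha.eLpNorm_two_le hc)
      _ = _ := by push_cast; rfl
  refine ⟨Gj, hGj.eq_fourierInv ▸ flat.of_norm_le hGj.integrable fun ξ => ?_⟩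
  rw [abs_one, one_mul, abs_of_pos (hv.pos ξ)]
  by_cases hξ : ξ ∈ Gj.support
  · have norm_le := mem_closedBall_zero_iff.1 (support_Gj hξ)
    gcongr
    refine (growth ξ).trans ?_
    push_cast
    gcongr
  · rw [Function.notMem_support.1 hξ, norm_zero, mul_zero, mul_zero]

theorem isMultiplier_pow_of_support_subset (hv : IsAlgebraWeight v C) (hc : ∀ ξ, 1 ≤ c * |v ξ|)
    (growth : ∀ ξ, v ξ ≤ P * (1 + ‖ξ‖) ^ N) {R : ℝ≥0} (ha : HasSpectrum v a G M)
    (hG : G.support ⊆ Metric.closedBall 0 R) (s_pos : 0 < s) (hs : ∀ x, ‖a x‖ ≤ s) (j : ℕ) :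
    IsMultiplier v (a ^ j) ((1 + C * P * c * M / s) * (1 + j * R) ^ N * s ^ j) := by
  cases j with
  | zero => simpa using (IsMultiplier.one v).mono le_self_add
  | succ j =>
    refine (IsMultiplier.of_memBall hv
      (ha.memBall_pow_of_support_subset hv hc growth hG hs j)).mono ?_
    calc C * (P * (1 + (j + 1) * R) ^ N * (s ^ j * (c * M)))
        = C * P * c * M / s * (1 + (j + 1) * R) ^ N * s ^ (j + 1) := by
          rw [pow_succ]
          field_simp
      _ ≤ _ := by
          push_cast
          gcongr
          exact le_add_self

theorem exists_add_eq_support_subset (hv : IsWeight v) (hg : HasSpectrum w g G M) {ε : ℝ≥0}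
    (hc : ∀ ξ, |v ξ| ≤ c * |w ξ|) (hε : ∀ ξ, R < ‖ξ‖ → |v ξ| ≤ ε * |w ξ|) :
    ∃ a h A, a + h = g ∧ HasSpectrum v a A (c * M) ∧ A.support ⊆ Metric.closedBall 0 R ∧
      MemBall v h (ε * M) := by
  let E := Metric.closedBall (0 : V) R
  have hE : MeasurableSet E := measurableSet_closedBall
  have low := hg.indicator (v' := v) hE fun ξ _ => hc ξ
  have high := hg.indicator (v' := v) hE.compl fun ξ hξ =>
    hε ξ (by simpa only [E, Set.mem_compl_iff, mem_closedBall_zero_iff, not_le] using hξ)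
  refine ⟨_, _, _, ?_, low, Set.support_indicator_subset, _, high⟩
  rw [(low.add hv high).eq_fourierInv, Set.indicator_self_add_compl, hg.eq_fourierInv]

end HasSpectrum

/-- The band-limited part of `g` has sup norm at most `2 σ`, the other part has multiplier norm at
most `σ`. -/
theorem IsAlgebraWeight.exists_isMultiplier_pow (hv : IsAlgebraWeight v C)
    (hc : ∀ ξ, 1 ≤ c * |v ξ|) (growth : ∀ ξ, v ξ ≤ P * (1 + ‖ξ‖) ^ N) {B ε R σ : ℝ≥0}
    (hB : ∀ ξ, |v ξ| ≤ B * |w ξ|) (hε : ∀ ξ, R < ‖ξ‖ → |v ξ| ≤ ε * |w ξ|)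
    (σ_pos : 0 < σ) (hσ : C * (ε * M) ≤ σ) :
    ∃ D : ℝ≥0, ∀ g : V → ℂ, MemBall w g M → (∀ x, ‖g x‖ ≤ σ) → ∀ m : ℕ,
      IsMultiplier v (g ^ m) (D * (4 * σ) ^ m) := by
  let Q := 1 + C * P * c * (B * M) / (2 * σ)
  obtain ⟨D, hD⟩ := exists_one_add_mul_pow_mul_pow_le R N
    (mul_lt_mul_of_pos_right (by norm_num : (3 : ℝ≥0) < 4) σ_pos)
  refine ⟨Q * D, fun g ⟨G, hG⟩ norm_g_le m => ?_⟩
  obtain ⟨a, h, A, rfl, ha, support_A, hh⟩ := hG.exists_add_eq_support_subset hv.toIsWeight hB hε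
  have norm_h_le x : ‖h x‖ ≤ σ := (hh.norm_apply_le hv x).trans (by exact_mod_cast hσ)
  have norm_a_le x : ‖a x‖ ≤ (2 * σ : ℝ≥0) := by
    calc ‖a x‖ = ‖(a + h) x - h x‖ := by rw [Pi.add_apply, add_sub_cancel_right]
      _ ≤ ‖(a + h) x‖ + ‖h x‖ := norm_sub_le _ _
      _ ≤ σ + σ := add_le_add (norm_g_le x) (norm_h_le x)
      _ = _ := by push_cast; ring
  have low_pow := ha.isMultiplier_pow_of_support_subset hv hc growth support_A (by positivity)
    norm_a_le
  have coeff_mono : Monotone fun j : ℕ => Q * (1 + j * R) ^ N := fun i j hij => by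
    dsimp only
    gcongr
  refine (IsMultiplier.add_pow hv.toIsWeight coeff_mono low_pow
    ((IsMultiplier.of_memBall hv hh).mono hσ) m).mono ?_
  calc Q * (1 + m * R) ^ N * (2 * σ + σ) ^ m = Q * ((1 + m * R) ^ N * (3 * σ) ^ m) := by ring
    _ ≤ Q * (D * (4 * σ) ^ m) := mul_le_mul_right (hD m) Q
    _ = Q * D * (4 * σ) ^ m := by ring

/-- A spectral radius estimate, since the norms of `𝓑_w` and `𝓑_{w ^ δ + l w}` are equivalent. -/
theorem IsWienerLevyWeight.exists_isMultiplier_pow {δ : ℝ} (hw : IsWienerLevyWeight w δ)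
    {σ : ℝ≥0} (hσ : 0 < σ) (M : ℝ≥0) :
    ∃ l > 0, ∃ D : ℝ≥0, ∀ g : V → ℂ, MemBall w g M → (∀ x, ‖g x‖ ≤ σ) → ∀ m : ℕ,
      IsMultiplier (fun ξ => w ξ ^ δ + l * w ξ) (g ^ m) (D * (4 * σ) ^ m) := by
  obtain ⟨K, isAlgebraWeight⟩ := hw.exists_isAlgebraWeight_add
  obtain ⟨B, hB, rpow_le⟩ := hw.exists_rpow_le_mul
  obtain ⟨c, hc, c_le⟩ := hw.toIsModerate.exists_le_of_tendsto hw.tendsto_atTop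
  obtain ⟨P, N, growth⟩ := hw.toIsModerate.exists_le_mul_one_add_norm_pow
  lift B to ℝ≥0 using hB.le
  lift c to ℝ≥0 using hc.le
  obtain ⟨l, l_pos, hl⟩ := exists_pos_mul_lt hσ (2 * K * M)
  obtain ⟨S, hS, rpow_le_of_notMem⟩ :=
    Filter.mem_cocompact.1 (hw.eventually_rpow_le_mul (ε := l) (by exact_mod_cast l_pos))
  obtain ⟨R, hSR⟩ := hS.isBounded.subset_closedBall 0
  have w_pos := hw.pos
  have rpow_pos := hw.isWeight_rpow.pos
  have hv := isAlgebraWeight l (by exact_mod_cast l_pos)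
  have v_le ξ : w ξ ^ δ + l * w ξ ≤ (B + l) * w ξ := by linarith [rpow_le ξ]
  refine ⟨l, by exact_mod_cast l_pos, hv.exists_isMultiplier_pow (c := (l * c)⁻¹)
    (P := (B + l) * P) (N := N) (B := B + l) (ε := 2 * l) (R := R.toNNReal) (fun ξ => ?_)
    (fun ξ => ?_) (fun ξ => ?_) (fun ξ hξ => ?_) hσ ?_⟩
  · rw [abs_of_pos (hv.pos ξ), NNReal.coe_inv, NNReal.coe_mul, inv_mul_eq_div,
      one_le_div (by positivity)]
    exact le_add_of_nonneg_of_le (rpow_pos ξ).le (by gcongr; exact c_le ξ)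
  · refine (v_le ξ).trans ?_
    push_cast
    rw [mul_assoc]
    gcongr
    exact growth ξ
  · rw [abs_of_pos (hv.pos ξ), abs_of_pos (w_pos ξ)]
    exact_mod_cast v_le ξ
  · have hξS : ξ ∉ S := fun h => hξ.not_ge
      ((mem_closedBall_zero_iff.1 (hSR h)).trans (Real.le_coe_toNNReal R))
    have small : w ξ ^ δ ≤ l * w ξ := rpow_le_of_notMem hξS
    rw [abs_of_pos (hv.pos ξ), abs_of_pos (w_pos ξ)]
    push_cast
    linarith
  · calc K * (2 * l * M) = 2 * K * M * l := by ring
      _ ≤ σ := hl.le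

end SpectralRadius

section CauchyKernel

theorem hasSum_prod_pi {𝕜 : Type*} [NormedCommRing 𝕜] [CompleteSpace 𝕜] {ι : Type*} {d : ℕ}
    {f : Fin d → ι → 𝕜} {s : Fin d → 𝕜} (hf : ∀ i, Summable fun m => ‖f i m‖)
    (hs : ∀ i, HasSum (f i) (s i)) :
    (Summable fun α : Fin d → ι => ‖∏ i, f i (α i)‖) ∧
      HasSum (fun α : Fin d → ι => ∏ i, f i (α i)) (∏ i, s i) := by
  induction d with
  | zero => exact ⟨(hasSum_unique _).summable, by simp⟩
  | succ d ih =>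
    obtain ⟨summable_tail, hasSum_tail⟩ := ih (fun i => hf i.succ) fun i => hs i.succ
    have cons_prod (p : ι × (Fin d → ι)) :
        ∏ i, f i ((Fin.consEquiv fun _ : Fin (d + 1) => ι) p i) =
          f 0 p.1 * ∏ i : Fin d, f i.succ (p.2 i) := by
      simp [Fin.consEquiv, Fin.prod_univ_succ]
    constructor
    · rw [← (Fin.consEquiv fun _ : Fin (d + 1) => ι).summable_iff]
      exact (Summable.mul_norm (hf 0) summable_tail).congr fun p => by
        rw [Function.comp_apply, cons_prod]
    · rw [← (Fin.consEquiv fun _ : Fin (d + 1) => ι).hasSum_iff, Fin.prod_univ_succ]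
      have summable_mul := summable_mul_of_summable_norm (hf 0) summable_tail
      exact ((hs 0).mul hasSum_tail summable_mul).congr_fun fun p => by
        rw [Function.comp_apply, cons_prod]

variable {𝕜 : Type*} [NormedField 𝕜]

theorem hasSum_cauchyKernel {ζ z : 𝕜} (h : ‖z‖ < ‖ζ‖) :
    (Summable fun m : ℕ => ‖(ζ ^ (m + 1))⁻¹ * z ^ m‖) ∧
      HasSum (fun m : ℕ => (ζ ^ (m + 1))⁻¹ * z ^ m) (ζ - z)⁻¹ := by
  have ζ_ne : ζ ≠ 0 := norm_pos_iff.1 ((norm_nonneg z).trans_lt h)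
  have ratio_lt : ‖z / ζ‖ < 1 := by
    rw [norm_div]
    exact (div_lt_one (norm_pos_iff.2 ζ_ne)).2 h
  have geometric m : (ζ ^ (m + 1))⁻¹ * z ^ m = ζ⁻¹ * (z / ζ) ^ m := by
    rw [div_pow, pow_succ', mul_inv, div_eq_mul_inv]
    ring
  have limit : (ζ - z)⁻¹ = ζ⁻¹ * (1 - z / ζ)⁻¹ := by
    rw [← mul_inv, mul_sub, mul_one, mul_div_cancel₀ _ ζ_ne]
  simp only [geometric, limit, norm_mul, norm_pow]
  exact ⟨(summable_geometric_of_lt_one (norm_nonneg _) ratio_lt).mul_left _,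
    (hasSum_geometric_of_norm_lt_one ratio_lt).mul_left _⟩

theorem hasSum_prod_cauchyKernel [CompleteSpace 𝕜] {d : ℕ} {ζ z : Fin d → 𝕜}
    (h : ∀ i, ‖z i‖ < ‖ζ i‖) :
    (Summable fun α : Fin d → ℕ => ‖∏ i, (ζ i ^ (α i + 1))⁻¹ * z i ^ α i‖) ∧
      HasSum (fun α : Fin d → ℕ => ∏ i, (ζ i ^ (α i + 1))⁻¹ * z i ^ α i) (∏ i, (ζ i - z i)⁻¹) :=
  hasSum_prod_pi (f := fun i m => (ζ i ^ (m + 1))⁻¹ * z i ^ m)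
    (fun i => (hasSum_cauchyKernel (h i)).1) fun i => (hasSum_cauchyKernel (h i)).2

end CauchyKernel

section Torus

variable {d : ℕ} {a w : Fin d → ℂ} {R : Fin d → ℝ}

theorem norm_torusMap_sub (a : Fin d → ℂ) (R : Fin d → ℝ) (θ : Fin d → ℝ) (i : Fin d) :
    ‖torusMap a R θ i - a i‖ = |R i| := by
  rw [torusMap, add_sub_cancel_left, norm_mul, Complex.norm_exp_ofReal_mul_I, mul_one,
    Complex.norm_real, Real.norm_eq_abs]

theorem torusMap_sub_ne_zero {i : Fin d} (hw : ‖w i - a i‖ < |R i|) (θ : Fin d → ℝ) :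
    torusMap a R θ i - w i ≠ 0 := fun h => by
  rw [← sub_eq_zero.1 h, norm_torusMap_sub] at hw
  exact hw.false

theorem continuous_torusMap (a : Fin d → ℂ) (R : Fin d → ℝ) : Continuous (torusMap a R) := by
  unfold torusMap
  fun_prop

theorem continuous_inv_torusMap_sub_pow {i : Fin d} (hw : ‖w i - a i‖ < |R i|) (m : ℕ) :
    Continuous fun θ => ((torusMap a R θ i - w i) ^ m)⁻¹ :=
  ((((continuous_apply i).comp (continuous_torusMap a R)).sub continuous_const).pow m).inv₀
    fun θ => pow_ne_zero m (torusMap_sub_ne_zero hw θ)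

/-- The closed polydisc with centre `a` and polyradius `R`. -/
def closedPolydisc (a : Fin d → ℂ) (R : Fin d → ℝ) : Set (Fin d → ℂ) :=
  Set.univ.pi fun i => Metric.closedBall (a i) (R i)

theorem cons_mem_closedPolydisc {a : Fin (d + 1) → ℂ} {R : Fin (d + 1) → ℝ} {x : ℂ}
    {y : Fin d → ℂ} : (Fin.cons x y : Fin (d + 1) → ℂ) ∈ closedPolydisc a R ↔
      x ∈ Metric.closedBall (a 0) (R 0) ∧ y ∈ closedPolydisc (a ∘ Fin.succ) (R ∘ Fin.succ) := by
  simp [closedPolydisc, Fin.forall_fin_succ]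

theorem torusMap_mem_closedPolydisc (hR : ∀ i, 0 ≤ R i) (θ : Fin d → ℝ) :
    torusMap a R θ ∈ closedPolydisc a R := fun i _ => by
  rw [Metric.mem_closedBall, dist_eq_norm, norm_torusMap_sub, abs_of_nonneg (hR i)]

theorem continuous_comp_torusMap {X : Type*} [TopologicalSpace X] {Φ : (Fin d → ℂ) → X}
    (hR : ∀ i, 0 ≤ R i) (hΦ : ContinuousOn Φ (closedPolydisc a R)) :
    Continuous fun θ => Φ (torusMap a R θ) :=
  hΦ.comp_continuous (continuous_torusMap a R) (torusMap_mem_closedPolydisc hR)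

variable {E : Type*} [NormedAddCommGroup E] [NormedSpace ℂ E] {Φ : (Fin d → ℂ) → E}

theorem hasSum_torusIntegral_of_norm_le {ι : Type*} [Countable ι] {F : ι → (Fin d → ℂ) → E}
    {f : (Fin d → ℂ) → E} {b : ι → ℝ} (hF : ∀ α, Continuous fun θ => F α (torusMap a R θ))
    (hb : Summable b) (hFb : ∀ α θ, ‖F α (torusMap a R θ)‖ ≤ b α)
    (hf : ∀ θ, HasSum (fun α => F α (torusMap a R θ)) (f (torusMap a R θ))) :
    HasSum (fun α => ∯ ζ in T(a, R), F α ζ) (∯ ζ in T(a, R), f ζ) := by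
  refine hasSum_integral_of_dominated_convergence (fun α _ => (∏ i, |R i|) * b α)
    (fun α => ?_) (fun α => ae_of_all _ fun θ => ?_) (ae_of_all _ fun _ => hb.mul_left _)
    continuous_const.integrableOn_Icc (ae_of_all _ fun θ => (hf θ).const_smul _)
  · exact (Continuous.smul (by fun_prop) (hF α)).aestronglyMeasurable
  · rw [norm_smul, norm_prod]
    simp only [norm_mul, Complex.norm_exp_ofReal_mul_I, Complex.norm_I, mul_one,
      Complex.norm_real, Real.norm_eq_abs]
    exact mul_le_mul_of_nonneg_left (hFb α θ) (by positivity)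

theorem torusIntegral_prod_sub_inv_smul [CompleteSpace E]
    (hΦ : DifferentiableOn ℂ Φ (closedPolydisc a R)) (hw : ∀ i, ‖w i - a i‖ < R i) :
    (∯ ζ in T(a, R), (∏ i, (ζ i - w i)⁻¹) • Φ ζ) = (2 * Real.pi * Complex.I) ^ d • Φ w := by
  induction d with
  | zero =>
    rw [torusIntegral_dim0, Subsingleton.elim w a]
    simp
  | succ d ih =>
    have R_pos i : 0 < R i := (norm_nonneg _).trans_lt (hw i)
    have kernel_continuous i : Continuous fun θ => (torusMap a R θ i - w i)⁻¹ := by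
      simpa only [pow_one] using
        continuous_inv_torusMap_sub_pow ((hw i).trans_le (le_abs_self _)) 1
    have integrable : TorusIntegrable (fun ζ => (∏ i, (ζ i - w i)⁻¹) • Φ ζ) a R :=
      ((continuous_finsetProd _ fun i _ => kernel_continuous i).smul (continuous_comp_torusMap
        (fun i => (R_pos i).le) hΦ.continuousOn)).integrableOn_Icc
    have tail_mem : w ∘ Fin.succ ∈ closedPolydisc (a ∘ Fin.succ) (R ∘ Fin.succ) := fun i _ =>
      mem_closedBall_iff_norm.2 (hw i.succ).le
    have inner_eq x (hx : x ∈ Metric.closedBall (a 0) (R 0)) :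
        (∯ y in T(a ∘ Fin.succ, R ∘ Fin.succ),
          (∏ i, ((Fin.cons x y : Fin (d + 1) → ℂ) i - w i)⁻¹) • Φ (Fin.cons x y)) =
        (x - w 0)⁻¹ • (2 * Real.pi * Complex.I) ^ d • Φ (Fin.cons x (w ∘ Fin.succ)) := by
      have slice : DifferentiableOn ℂ (fun y => Φ (Fin.cons x y))
          (closedPolydisc (a ∘ Fin.succ) (R ∘ Fin.succ)) :=
        hΦ.comp (by fun_prop) fun y hy => cons_mem_closedPolydisc.2 ⟨hx, hy⟩
      rw [← ih (w := w ∘ Fin.succ) slice (fun i => hw i.succ), ← torusIntegral_smul]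
      simp only [Fin.prod_univ_succ, Fin.cons_zero, Fin.cons_succ, mul_smul, Function.comp_apply]
    have slice : DifferentiableOn ℂ
        (fun x => (2 * Real.pi * Complex.I : ℂ) ^ d • Φ (Fin.cons x (w ∘ Fin.succ)))
        (Metric.closedBall (a 0) (R 0)) :=
      (hΦ.comp (by fun_prop) fun x hx => cons_mem_closedPolydisc.2 ⟨hx, tail_mem⟩).const_smul _
    rw [torusIntegral_succ integrable, circleIntegral.integral_congr (R_pos 0).le fun x hx =>
      inner_eq x (Metric.sphere_subset_closedBall hx), slice.circleIntegral_sub_inv_smul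
        (mem_ball_iff_norm.2 (hw 0)), smul_smul, pow_succ']
    congr 2
    exact Fin.cons_self_tail w

/-- The coefficients of the Taylor expansion of `Φ` at `a`, by Cauchy's formula on the
distinguished boundary of a polydisc with polyradius `R`. -/
def cauchyCoeff (Φ : (Fin d → ℂ) → E) (a : Fin d → ℂ) (R : Fin d → ℝ) (α : Fin d → ℕ) : E :=
  ((2 * Real.pi * Complex.I) ^ d)⁻¹ •
    ∯ ζ in T(a, R), (∏ i, ((ζ i - a i) ^ (α i + 1))⁻¹) • Φ ζ

theorem norm_cauchyCoeff_le (hR : ∀ i, 0 < R i) {S : ℝ}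
    (hS : ∀ z ∈ closedPolydisc a R, ‖Φ z‖ ≤ S) (α : Fin d → ℕ) :
    ‖cauchyCoeff Φ a R α‖ ≤ S * ∏ i, (R i)⁻¹ ^ α i := by
  have norm_le := norm_torusIntegral_le_of_norm_le_const (c := a) (R := R)
    (f := fun ζ => (∏ i, ((ζ i - a i) ^ (α i + 1))⁻¹) • Φ ζ)
    (C := (∏ i, (R i ^ (α i + 1))⁻¹) * S) fun θ => by
      rw [norm_smul, norm_prod]
      simp only [norm_inv, norm_pow, norm_torusMap_sub, abs_of_pos (hR _)]
      exact mul_le_mul_of_nonneg_left (hS _ (torusMap_mem_closedPolydisc (fun i => (hR i).le) θ))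
        (Finset.prod_nonneg fun i _ => by have := (hR i).le; positivity)
  have cancel : (∏ i, R i) * ∏ i, (R i ^ (α i + 1))⁻¹ = ∏ i, (R i)⁻¹ ^ α i := by
    rw [← Finset.prod_mul_distrib]
    refine Finset.prod_congr rfl fun i _ => ?_
    have := (hR i).ne'
    rw [pow_succ, inv_pow]
    field_simp
  have norm_two_pi_I : ‖(2 * Real.pi * Complex.I : ℂ)‖ = 2 * Real.pi := by
    simp [abs_of_pos Real.pi_pos]
  rw [cauchyCoeff, norm_smul, norm_inv, norm_pow, norm_two_pi_I, inv_mul_le_iff₀ (by positivity)]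
  refine norm_le.trans (le_of_eq ?_)
  simp only [abs_of_pos (hR _), ← cancel]
  ring

theorem hasSum_torusIntegral_cauchyKernel_smul (hΦ : ContinuousOn Φ (closedPolydisc a R))
    {S : ℝ} (hS : ∀ z ∈ closedPolydisc a R, ‖Φ z‖ ≤ S) {z : Fin d → ℂ}
    (hz : ∀ i, ‖z i‖ < R i) :
    HasSum (fun α : Fin d → ℕ =>
        ∯ ζ in T(a, R), (∏ i, ((ζ i - a i) ^ (α i + 1))⁻¹ * z i ^ α i) • Φ ζ)
      (∯ ζ in T(a, R), (∏ i, (ζ i - (a + z) i)⁻¹) • Φ ζ) := by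
  have R_pos i : 0 < R i := (norm_nonneg _).trans_lt (hz i)
  have mem_torus θ := torusMap_mem_closedPolydisc (a := a) (fun i => (R_pos i).le) θ
  let K (α : Fin d → ℕ) (ζ : Fin d → ℂ) := ∏ i, ((ζ i - a i) ^ (α i + 1))⁻¹ * z i ^ α i
  have norm_K α θ : ‖K α (torusMap a R θ)‖ = ∏ i, (R i ^ (α i + 1))⁻¹ * ‖z i‖ ^ α i := by
    simp only [K, norm_prod, norm_mul, norm_inv, norm_pow, norm_torusMap_sub, abs_of_pos (R_pos _)]
  have kernel θ := hasSum_prod_cauchyKernel (ζ := torusMap a R θ - a) (z := z) fun i => by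
    rw [Pi.sub_apply, norm_torusMap_sub, abs_of_pos (R_pos i)]
    exact hz i
  refine hasSum_torusIntegral_of_norm_le
    (b := fun α => (∏ i, (R i ^ (α i + 1))⁻¹ * ‖z i‖ ^ α i) * S) (fun α => ?_) ?_
    (fun α θ => ?_) fun θ => ?_
  · refine (continuous_finsetProd _ fun i _ => ?_).smul
      (continuous_comp_torusMap (fun i => (R_pos i).le) hΦ)
    refine (continuous_inv_torusMap_sub_pow ?_ _).mul continuous_const
    rw [sub_self, norm_zero, abs_of_pos (R_pos i)]
    exact R_pos i
  · simpa only [norm_K, K, Pi.sub_apply] using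
      ((kernel 0).1.congr fun α => norm_K α 0).mul_right S
  · rw [norm_smul, norm_K]
    exact mul_le_mul_of_nonneg_left (hS _ (mem_torus θ))
      (Finset.prod_nonneg fun i _ => by have := (R_pos i).le; positivity)
  · simpa only [Pi.sub_apply, Pi.add_apply, sub_sub] using (kernel θ).2.smul_const (Φ _)

theorem hasSum_cauchyCoeff [CompleteSpace E] (hΦ : DifferentiableOn ℂ Φ (closedPolydisc a R))
    {S : ℝ} (hS : ∀ z ∈ closedPolydisc a R, ‖Φ z‖ ≤ S) {z : Fin d → ℂ}
    (hz : ∀ i, ‖z i‖ < R i) :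
    HasSum (fun α => (∏ i, z i ^ α i) • cauchyCoeff Φ a R α) (Φ (a + z)) := by
  have expansion := hasSum_torusIntegral_cauchyKernel_smul hΦ.continuousOn hS hz
  rw [torusIntegral_prod_sub_inv_smul hΦ (by simpa using hz)] at expansion
  have two_pi_I_ne : (2 * Real.pi * Complex.I : ℂ) ^ d ≠ 0 :=
    pow_ne_zero _ Complex.two_pi_I_ne_zero
  have normalized := expansion.const_smul ((2 * Real.pi * Complex.I : ℂ) ^ d)⁻¹
  rw [inv_smul_smul₀ two_pi_I_ne] at normalized
  refine normalized.congr_fun fun α => ?_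
  rw [cauchyCoeff, smul_comm (∏ i, z i ^ α i), ← torusIntegral_smul]
  simp only [Finset.prod_mul_distrib, mul_comm, mul_smul]

end Torus

section Equicontinuity

open Filter Topology

variable {V : Type*} [NormedAddCommGroup V] [InnerProductSpace ℝ V]

theorem continuous_fourierChar_inner :
    Continuous fun p : V × V => ((Real.fourierChar (inner ℝ p.1 p.2) : Circle) : ℂ) :=
  continuous_subtype_val.comp (Real.continuous_fourierChar.comp (by fun_prop))

variable [MeasurableSpace V] [BorelSpace V]

theorem tendsto_lintegral_fourierChar_sub_one [SecondCountableTopology V] {μ : Measure V}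
    {F : V → ℂ} (hF : MemLp F 2 μ) :
    Tendsto (fun h : V => ∫⁻ ξ, ‖((Real.fourierChar (inner ℝ ξ h) : ℂ) - 1) * F ξ‖ₑ ^ 2 ∂μ)
      (𝓝 0) (𝓝 0) := by
  have char_continuous (h : V) : Continuous fun ξ : V =>
      ((Real.fourierChar (inner ℝ ξ h) : Circle) : ℂ) - 1 :=
    (continuous_fourierChar_inner.comp (by fun_prop : Continuous fun ξ : V => (ξ, h))).sub
      continuous_const
  have norm_char_le (ξ h : V) : ‖((Real.fourierChar (inner ℝ ξ h) : Circle) : ℂ) - 1‖ ≤ 2 := by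
    refine (norm_sub_le _ _).trans ?_
    rw [Circle.norm_coe, norm_one, one_add_one_eq_two]
  have dominating_finite : ∫⁻ ξ, ‖2 * F ξ‖ₑ ^ 2 ∂μ ≠ ⊤ := by
    rw [← eLpNorm_two_sq]
    exact ENNReal.pow_ne_top (hF.const_mul 2).2.ne
  rw [← lintegral_zero (μ := μ)]
  refine tendsto_lintegral_filter_of_dominated_convergence' (fun ξ => ‖2 * F ξ‖ₑ ^ 2)
    (.of_forall fun h => (((char_continuous h).aestronglyMeasurable.mul hF.1).enorm.pow_const 2))
    (.of_forall fun h => ae_of_all _ fun ξ => ?_) dominating_finite (ae_of_all _ fun ξ => ?_)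
  · gcongr ?_ ^ 2
    refine enorm_le_iff_norm_le.2 ?_
    rw [norm_mul, norm_mul, RCLike.norm_ofNat]
    gcongr
    exact norm_char_le ξ h
  · have continuous_at_zero : Continuous fun h : V =>
        ‖(((Real.fourierChar (inner ℝ ξ h) : Circle) : ℂ) - 1) * F ξ‖ₑ ^ 2 :=
      (ENNReal.continuous_pow 2).comp (((continuous_fourierChar_inner.comp
        (by fun_prop : Continuous fun h : V => (ξ, h))).sub continuous_const).mul
          continuous_const).enorm
    simpa using continuous_at_zero.tendsto 0

variable [FiniteDimensional ℝ V] {v : V → ℝ} {C M : ℝ≥0} {g G : V → ℂ}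

theorem HasSpectrum.sq_enorm_sub_le (hv : IsWeight v) (h : HasSpectrum v g G M) (x y : V) :
    ‖g x - g y‖ₑ ^ 2 ≤
      (∫⁻ ξ, ‖((Real.fourierChar (inner ℝ ξ (x - y)) : ℂ) - 1) * (v ξ : ℂ)⁻¹‖ₑ ^ 2) * M ^ 2 := by
  have integrable_char (z : V) : Integrable fun ξ => Real.fourierChar (inner ℝ ξ z) • G ξ := by
    simpa using (Real.fourierIntegral_convergent_iff (-z)).2 h.integrable
  have difference : g x - g y = ∫ ξ, Real.fourierChar (inner ℝ ξ y) •
      (((Real.fourierChar (inner ℝ ξ (x - y)) : ℂ) - 1) * (v ξ : ℂ)⁻¹ * ((v ξ : ℂ) * G ξ)) := by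
    rw [h.eq_fourierInv, Real.fourierInv_eq, Real.fourierInv_eq,
      ← integral_sub (integrable_char x) (integrable_char y)]
    refine integral_congr_ae (ae_of_all _ fun ξ => ?_)
    have := hv.ofReal_ne_zero ξ
    have char_add : Real.fourierChar (inner ℝ ξ x) =
        Real.fourierChar (inner ℝ ξ y) * Real.fourierChar (inner ℝ ξ (x - y)) := by
      rw [← AddChar.map_add_eq_mul, ← inner_add_right, add_sub_cancel]
    simp only [char_add, Circle.smul_def, smul_eq_mul, Circle.coe_mul]
    field_simp
  have char_measurable : AEStronglyMeasurable (fun ξ =>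
      ((Real.fourierChar (inner ℝ ξ (x - y)) : Circle) : ℂ) - 1) volume :=
    ((continuous_fourierChar_inner.comp (by fun_prop : Continuous fun ξ : V =>
      (ξ, x - y))).sub continuous_const).aestronglyMeasurable
  calc ‖g x - g y‖ₑ ^ 2
      ≤ (∫⁻ ξ, ‖((Real.fourierChar (inner ℝ ξ (x - y)) : ℂ) - 1) * (v ξ : ℂ)⁻¹‖ₑ *
          ‖(v ξ : ℂ) * G ξ‖ₑ) ^ 2 := by
        rw [difference]
        gcongr
        refine (enorm_integral_le_lintegral_enorm _).trans (lintegral_mono fun ξ => le_of_eq ?_)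
        rw [← enorm_mul, ← ofReal_norm, Circle.norm_smul, ofReal_norm]
    _ ≤ _ := sq_lintegral_mul_le (char_measurable.mul hv.aestronglyMeasurable.inv₀).enorm
        (hv.aestronglyMeasurable.mul h.integrable.aestronglyMeasurable).enorm
    _ ≤ _ := by
        gcongr
        exact eLpNorm_two_le_iff.1 h.eLpNorm_le

theorem IsAlgebraWeight.uniformEquicontinuous_memBall (hv : IsAlgebraWeight v C) (M : ℝ≥0) :
    UniformEquicontinuous fun g : {g : V → ℂ // MemBall v g M} => (g : V → ℂ) := by
  have memLp_inv : MemLp (fun ξ => (v ξ : ℂ)⁻¹) 2 volume :=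
    ⟨hv.aestronglyMeasurable.inv₀, hv.eLpNorm_inv_le.trans_lt ENNReal.coe_lt_top⟩
  have modulus_tendsto := ENNReal.Tendsto.mul_const (b := (M : ℝ≥0∞) ^ 2)
    (tendsto_lintegral_fourierChar_sub_one memLp_inv) (.inr (by simp))
  rw [zero_mul] at modulus_tendsto
  refine Metric.uniformEquicontinuous_iff.2 fun ε hε => ?_
  obtain ⟨r, hr, hball⟩ := Metric.eventually_nhds_iff.1
    (modulus_tendsto.eventually_lt_const (by positivity : 0 < ENNReal.ofReal ε ^ 2))
  refine ⟨r, hr, fun x y hxy ⟨g, G, hG⟩ => ?_⟩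
  have sq_lt := (hG.sq_enorm_sub_le hv.toIsWeight x y).trans_lt
    (hball (by rwa [dist_zero_right, ← dist_eq_norm]))
  rw [ENNReal.pow_lt_pow_left_iff two_ne_zero, ← ofReal_norm, ← dist_eq_norm] at sq_lt
  exact (ENNReal.ofReal_lt_ofReal_iff hε).1 sq_lt

end Equicontinuity

section LocalTheory

open Filter Topology

theorem exists_contDiff_eventuallyEq_one {E : Type*} [NormedAddCommGroup E] [NormedSpace ℝ E]
    [FiniteDimensional ℝ E] [HasContDiffBump E] {U : Set E} (hU : U ∈ 𝓝 0) :
    ∃ χ : E → ℂ, ContDiff ℝ ∞ χ ∧ HasCompactSupport χ ∧ tsupport χ ⊆ U ∧ χ =ᶠ[𝓝 0] 1 ∧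
      ∀ x, ‖χ x‖ ≤ 1 := by
  obtain ⟨r, hr, hrU⟩ := Metric.nhds_basis_closedBall.mem_iff.1 hU
  let B : ContDiffBump (0 : E) := ⟨r / 2, r, by positivity, by linarith⟩
  have tsupport_le : tsupport (fun x => (B x : ℂ)) ⊆ tsupport B :=
    closure_mono fun x hx hB => hx (by simp [hB])
  refine ⟨fun x => (B x : ℂ), Complex.ofRealCLM.contDiff.comp B.contDiff,
    B.hasCompactSupport.comp_left (g := ((↑) : ℝ → ℂ)) rfl,
    tsupport_le.trans (B.tsupport_eq.subset.trans hrU), ?_, fun x => ?_⟩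
  · filter_upwards [B.eventuallyEq_one] with x hx
    simp [hx]
  · rw [Complex.norm_real, Real.norm_of_nonneg B.nonneg]
    exact B.le_one

variable {V : Type*} [NormedAddCommGroup V] [InnerProductSpace ℝ V] [FiniteDimensional ℝ V]
  [MeasurableSpace V] [BorelSpace V] {w : V → ℝ} {K : ℝ≥0} {f : V → ℂ}

theorem IsModerate.exists_memBall (hw : IsModerate w) {θ : V → ℂ} (hθ : ContDiff ℝ ∞ θ)
    (hθc : HasCompactSupport θ) : ∃ M, MemBall w θ M := by
  obtain ⟨P, N, growth⟩ := hw.exists_le_mul_one_add_norm_pow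
  obtain ⟨φ, rfl⟩ : ∃ φ : 𝓢(V, ℂ), (φ : V → ℂ) = θ := ⟨hθc.toSchwartzMap hθ, rfl⟩
  have temperate : (fun ξ : V => ((1 : ℝ) + ‖ξ‖ ^ 2) ^ N).HasTemperateGrowth := by fun_prop
  have memLp_polynomial : MemLp (fun ξ => ((1 : ℝ) + ‖ξ‖ ^ 2) ^ N • (𝓕 φ) ξ) 2 volume := by
    have := (SchwartzMap.smulLeftCLM ℂ (fun ξ : V => ((1 : ℝ) + ‖ξ‖ ^ 2) ^ N) (𝓕 φ)).memLp 2
    rwa [SchwartzMap.smulLeftCLM_apply temperate] at this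
  have memLp_weight : MemLp (fun ξ => (w ξ : ℂ) * (𝓕 φ) ξ) 2 volume := by
    refine memLp_polynomial.of_le_mul (c := P * 2 ^ N)
      (hw.aestronglyMeasurable.mul (𝓕 φ).continuous.aestronglyMeasurable)
      (ae_of_all _ fun ξ => ?_)
    rw [norm_mul, norm_smul, Complex.norm_real, Real.norm_of_nonneg (hw.pos ξ).le,
      Real.norm_of_nonneg (by positivity), ← mul_assoc, mul_assoc (P : ℝ), ← mul_pow]
    gcongr
    refine (growth ξ).trans ?_
    gcongr
    nlinarith [sq_nonneg (‖ξ‖ - 1), norm_nonneg ξ]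
  refine ⟨_, (𝓕 φ : 𝓢(V, ℂ)), (𝓕 φ).integrable,
    (ENNReal.coe_toNNReal memLp_weight.eLpNorm_ne_top).ge, ?_⟩
  rw [← SchwartzMap.fourierInv_coe, FourierTransform.fourierInv_fourier_eq]

/-- `f` belongs to `𝓑_w` locally and uniformly with respect to translations: the products of `f`
with the translates of a cutoff function of small support lie in a ball of `𝓑_w`. -/
def UnifLocMem (w : V → ℝ) (f : V → ℂ) : Prop :=
  ∃ U ∈ 𝓝 (0 : V), ∀ θ : V → ℂ, ContDiff ℝ ∞ θ → HasCompactSupport θ → tsupport θ ⊆ U →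
    ∃ M, ∀ z, MemBall w (fun x => θ (x - z) * f x) M

namespace UnifLocMem

theorem exists_cutoff (hf : UnifLocMem w f) {U : Set V} (hU : U ∈ 𝓝 0) :
    ∃ χ : V → ℂ, ContDiff ℝ ∞ χ ∧ HasCompactSupport χ ∧ tsupport χ ⊆ U ∧ χ =ᶠ[𝓝 0] 1 ∧
      (∀ x, ‖χ x‖ ≤ 1) ∧ ∃ M, ∀ z, MemBall w (fun x => χ (x - z) * f x) M := by
  obtain ⟨U', hU', hUf⟩ := hf
  obtain ⟨χ, smooth, compact, subset, eq_one, le_one⟩ :=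
    exists_contDiff_eventuallyEq_one (inter_mem hU hU')
  exact ⟨χ, smooth, compact, subset.trans Set.inter_subset_left, eq_one, le_one,
    hUf χ smooth compact (subset.trans Set.inter_subset_right)⟩

theorem exists_norm_le (hw : IsAlgebraWeight w K) (hf : UnifLocMem w f) :
    ∃ B : ℝ≥0, ∀ x, ‖f x‖ ≤ B := by
  obtain ⟨χ, -, -, -, eq_one, -, M, hM⟩ := hf.exists_cutoff univ_mem
  refine ⟨K * M, fun x => ?_⟩
  simpa [eq_one.self_of_nhds] using (hM x).norm_apply_le hw x

theorem uniformContinuous (hw : IsAlgebraWeight w K) (hf : UnifLocMem w f) :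
    UniformContinuous f := by
  obtain ⟨χ, -, -, -, eq_one, -, M, hM⟩ := hf.exists_cutoff univ_mem
  obtain ⟨r, hr, χ_eq_one⟩ := Metric.eventually_nhds_iff.1 eq_one
  refine Metric.uniformContinuous_iff.2 fun ε hε => ?_
  obtain ⟨s, hs, dist_lt⟩ :=
    Metric.uniformEquicontinuous_iff.1 (hw.uniformEquicontinuous_memBall M) ε hε
  refine ⟨min r s, lt_min hr hs, fun x y hxy => ?_⟩
  have χ_sub : χ (x - y) = 1 :=
    χ_eq_one (by rw [dist_zero_right, ← dist_eq_norm]; exact hxy.trans_le (min_le_left _ _))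
  simpa [χ_sub, eq_one.self_of_nhds] using
    dist_lt x y (hxy.trans_le (min_le_right _ _)) ⟨_, hM y⟩

theorem isBounded_range {ι : Type*} {f : V → ι → ℂ} (hw : IsAlgebraWeight w K)
    (hf : ∀ j, UnifLocMem w fun x => f x j) : Bornology.IsBounded (Set.range f) := by
  refine Bornology.forall_isBounded_image_eval_iff.1 fun j => ?_
  obtain ⟨B, hB⟩ := (hf j).exists_norm_le hw
  refine isBounded_iff_forall_norm_le.2 ⟨B, ?_⟩
  rintro _ ⟨_, ⟨x, rfl⟩, rfl⟩
  exact hB x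

theorem exists_cutoff_sub (hw : IsModerate w) (hK : IsAlgebraWeight w K) (hf : UnifLocMem w f)
    {σ : ℝ} (hσ : 0 < σ) : ∃ χ : V → ℂ, χ =ᶠ[𝓝 0] 1 ∧ ∃ M, ∀ z,
      MemBall w (fun x => χ (x - z) * (f x - f z)) M ∧ ∀ x, ‖χ (x - z) * (f x - f z)‖ ≤ σ := by
  obtain ⟨s, hs, dist_lt⟩ := Metric.uniformContinuous_iff.1 (hf.uniformContinuous hK) σ hσ
  obtain ⟨χ, smooth, compact, subset, eq_one, le_one, M, hM⟩ :=
    hf.exists_cutoff (Metric.ball_mem_nhds 0 hs)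
  obtain ⟨Mχ, hχ⟩ := hw.exists_memBall smooth compact
  obtain ⟨B, hB⟩ := hf.exists_norm_le hK
  refine ⟨χ, eq_one, M + B * Mχ, fun z => ⟨?_, fun x => ?_⟩⟩
  · have expand : (fun x => χ (x - z) * (f x - f z)) =
        (fun x => χ (x - z) * f x) + -f z • fun x => χ (x - z) := by
      ext x
      simp only [Pi.add_apply, Pi.smul_apply, smul_eq_mul]
      ring
    rw [expand]
    refine ((hM z).add hw.toIsWeight ((hχ.comp_sub z).const_smul _)).mono ?_
    gcongr
    rw [nnnorm_neg]
    exact_mod_cast hB z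
  · by_cases hx : x - z ∈ tsupport χ
    · have hxz : dist x z < s := by simpa [dist_eq_norm] using subset hx
      rw [norm_mul, ← dist_eq_norm]
      exact (mul_le_of_le_one_left dist_nonneg (le_one _)).trans (dist_lt hxz).le
    · rw [image_eq_zero_of_notMem_tsupport hx, zero_mul, norm_zero]
      exact hσ.le

end UnifLocMem

end LocalTheory

section WienerLevy

open Filter Topology

theorem hasSum_prod_pi_geometric (D : ℝ≥0) {q : ℝ≥0} (hq : q < 1) (d : ℕ) :
    HasSum (fun α : Fin d → ℕ => ∏ i, D * q ^ α i) ((D * (1 - q)⁻¹) ^ d) := by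
  have hasSum_coe : HasSum (fun m => (D * q ^ m : ℝ)) (D * (1 - q)⁻¹ : ℝ≥0) := by
    exact_mod_cast (NNReal.hasSum_geometric hq).mul_left D
  have := (hasSum_prod_pi (fun _ : Fin d => hasSum_coe.summable.norm) fun _ => hasSum_coe).2
  rw [Fin.prod_const] at this
  exact_mod_cast this

variable {V : Type*} [NormedAddCommGroup V] [InnerProductSpace ℝ V] [FiniteDimensional ℝ V]
  [MeasurableSpace V] [BorelSpace V] {w v : V → ℝ} {δ : ℝ} {d : ℕ}

/-- Taylor expansion of `Φ` at `a`: geometric control of the powers of the `g i` as multipliers is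
a spectral radius estimate, so it is enough that `s` be smaller than the polyradius. -/
theorem MemBall.mul_comp_add {C M D s ρ S : ℝ≥0} (hv : IsAlgebraWeight v C) {ψ : V → ℂ}
    (hψ : MemBall v ψ M) {g : Fin d → V → ℂ}
    (hg : ∀ i m, IsMultiplier v (g i ^ m) (D * s ^ m)) (hsρ : s < ρ) (hgρ : ∀ i x, ‖g i x‖ < ρ)
    {Φ : (Fin d → ℂ) → ℂ} {a : Fin d → ℂ}
    (hΦ : DifferentiableOn ℂ Φ (closedPolydisc a fun _ => ρ))
    (hS : ∀ ζ ∈ closedPolydisc a fun _ => ρ, ‖Φ ζ‖ ≤ S) :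
    MemBall v (fun x => ψ x * Φ (a + fun i => g i x)) (M * S * (D * (1 - s / ρ)⁻¹) ^ d) := by
  have ρ_pos : 0 < ρ := hsρ.bot_lt
  let c := cauchyCoeff Φ a fun _ => ρ
  have term_mem α : MemBall v (c α • (ψ * ∏ i, g i ^ α i))
      (M * S * ∏ i, D * (s / ρ) ^ α i) := by
    have norm_c_le : ‖c α‖₊ ≤ S * ∏ i, ρ⁻¹ ^ α i := by
      exact_mod_cast norm_cauchyCoeff_le (fun _ => NNReal.coe_pos.2 ρ_pos) hS α
    refine ((IsMultiplier.prod Finset.univ fun i _ => hg i (α i)) ψ M hψ).const_smul (c α)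
      |>.mono ?_
    calc ‖c α‖₊ * (M * ∏ i, D * s ^ α i)
        ≤ (S * ∏ i, ρ⁻¹ ^ α i) * (M * ∏ i, D * s ^ α i) := by gcongr
      _ = M * S * ∏ i, ρ⁻¹ ^ α i * (D * s ^ α i) := by
        rw [Finset.prod_mul_distrib (g := fun i => D * s ^ α i)]
        ring
      _ = M * S * ∏ i, D * (s / ρ) ^ α i := by
        refine congrArg _ (Finset.prod_congr rfl fun i _ => ?_)
        rw [div_eq_mul_inv, mul_pow]
        ring
  have hasSum_radius :=
    (hasSum_prod_pi_geometric D ((div_lt_one ρ_pos).2 hsρ) d).mul_left (M * S)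
  rw [← hasSum_radius.tsum_eq]
  refine MemBall.hasSum hv term_mem hasSum_radius.summable fun x => ?_
  refine ((hasSum_cauchyCoeff hΦ hS fun i => hgρ i x).mul_left (ψ x)).congr_fun fun α => ?_
  simp only [c, Pi.smul_apply, Pi.mul_apply, Finset.prod_apply, Pi.pow_apply, smul_eq_mul]
  ring

theorem exists_closedPolydisc_subset {K Ω : Set (Fin d → ℂ)} (hK : IsCompact K) (hΩ : IsOpen Ω)
    (hKΩ : K ⊆ Ω) {Φ : (Fin d → ℂ) → ℂ} (hΦ : ContinuousOn Φ Ω) :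
    ∃ ρ S : ℝ≥0, 0 < ρ ∧ ∀ a ∈ K, (closedPolydisc a fun _ => ρ) ⊆ Ω ∧
      ∀ ζ ∈ closedPolydisc a fun _ => ρ, ‖Φ ζ‖ ≤ S := by
  obtain ⟨ρ, hρ, thickening_subset⟩ := hK.exists_cthickening_subset_open hΩ hKΩ
  lift ρ to ℝ≥0 using hρ.le
  have polydisc_subset a (ha : a ∈ K) :
      (closedPolydisc a fun _ => ρ) ⊆ Metric.cthickening ρ K := by
    rw [closedPolydisc, ← closedBall_pi _ ρ.coe_nonneg]
    exact Metric.closedBall_subset_cthickening ha ρ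
  obtain ⟨S, hS⟩ := (hK.cthickening (r := ρ)).exists_bound_of_continuousOn
    (hΦ.mono thickening_subset)
  exact ⟨ρ, S.toNNReal, NNReal.coe_pos.1 hρ, fun a ha =>
    ⟨(polydisc_subset a ha).trans thickening_subset, fun ζ hζ =>
      (hS ζ (polydisc_subset a ha hζ)).trans (Real.le_coe_toNNReal S)⟩⟩

theorem IsWienerLevyWeight.exists_memBall_mul_comp_add (hw : IsWienerLevyWeight w δ) {ρ : ℝ≥0}
    (ρ_pos : 0 < ρ) (S M Mψ : ℝ≥0) : ∃ M' : ℝ≥0, ∀ (ψ : V → ℂ) (g : Fin d → V → ℂ)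
      (Φ : (Fin d → ℂ) → ℂ) (a : Fin d → ℂ), MemBall w ψ Mψ → (∀ i, MemBall w (g i) M) →
      (∀ i x, ‖g i x‖ ≤ ρ / 8) → DifferentiableOn ℂ Φ (closedPolydisc a fun _ => ρ) →
      (∀ ζ ∈ closedPolydisc a fun _ => ρ, ‖Φ ζ‖ ≤ S) →
      MemBall w (fun x => ψ x * Φ (a + fun i => g i x)) M' := by
  obtain ⟨l, hl, D, hD⟩ := hw.exists_isMultiplier_pow (σ := ρ / 8) (by positivity) M
  obtain ⟨B, hB, rpow_le⟩ := hw.exists_rpow_le_mul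
  obtain ⟨K, hK⟩ := hw.exists_isAlgebraWeight_add
  lift l to ℝ≥0 using hl.le
  lift B to ℝ≥0 using hB.le
  have hv : IsAlgebraWeight (fun ξ => w ξ ^ δ + l * w ξ) K := hK l hl
  have s_lt : 4 * (ρ / 8) < ρ := by
    rw [← NNReal.coe_lt_coe]; push_cast; linarith [NNReal.coe_pos.2 ρ_pos]
  refine ⟨l⁻¹ * ((B + l) * Mψ * S * (D * (1 - 4 * (ρ / 8) / ρ)⁻¹) ^ d),
    fun ψ g Φ a hψ hg hgρ hΦ hS => ?_⟩
  have hψ_add : MemBall (fun ξ => w ξ ^ δ + l * w ξ) ψ ((B + l) * Mψ) := hψ.mono_weight fun ξ => by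
    rw [abs_of_pos (hv.pos ξ), abs_of_pos (hw.pos ξ), NNReal.coe_add, add_mul]
    exact add_le_add_left (rpow_le ξ) _
  refine (hψ_add.mul_comp_add hv (fun i m => hD (g i) (hg i) (fun x => ?_) m) s_lt
    (fun i x => (hgρ i x).trans_lt ?_) hΦ hS).mono_weight fun ξ => ?_
  · exact_mod_cast hgρ i x
  · linarith [NNReal.coe_pos.2 ρ_pos]
  · rw [abs_of_pos (hv.pos ξ), abs_of_pos (hw.pos ξ), NNReal.coe_inv, ← div_eq_inv_mul,
      le_div_iff₀' hl]
    linarith [Real.rpow_pos_of_pos (hw.pos ξ) δ]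

/-- Near `z`, `f` is the constant `f z` plus a small element of `𝓑_w` in a ball independent of
`z`. -/
theorem IsWienerLevyWeight.unifLocMem_comp (hw : IsWienerLevyWeight w δ) {f : V → Fin d → ℂ}
    (hf : ∀ j, UnifLocMem w fun x => f x j) {Ω : Set (Fin d → ℂ)} (hΩ : IsOpen Ω)
    {Φ : (Fin d → ℂ) → ℂ} (hΦ : DifferentiableOn ℂ Φ Ω) (hfΩ : closure (Set.range f) ⊆ Ω) :
    UnifLocMem w fun x => Φ (f x) := by
  obtain ⟨K, hK⟩ := hw.exists_isAlgebraWeight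
  obtain ⟨ρ, S, ρ_pos, hρ⟩ := exists_closedPolydisc_subset
    (UnifLocMem.isBounded_range hK hf).isCompact_closure hΩ hfΩ hΦ.continuousOn
  choose χ χ_eq_one M hM using fun j =>
    (hf j).exists_cutoff_sub hw.toIsModerate hK (σ := ρ / 8) (by positivity)
  refine ⟨{x | ∀ j, χ j x = 1}, eventually_all.2 χ_eq_one, fun ψ smooth compact hψχ => ?_⟩
  obtain ⟨Mψ, hψ⟩ := hw.toIsModerate.exists_memBall smooth compact
  obtain ⟨M', hM'⟩ := hw.exists_memBall_mul_comp_add (d := d) ρ_pos S (∑ j, M j) Mψ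
  refine ⟨M', fun z => ?_⟩
  let g j x := χ j (x - z) * (f x j - f z j)
  have g_mem j : MemBall w (g j) (∑ i, M i) :=
    (hM j z).1.mono (Finset.single_le_sum (fun _ _ => zero_le) (Finset.mem_univ j))
  have localize : (fun x => ψ (x - z) * Φ (f x)) =
      fun x => ψ (x - z) * Φ (f z + fun j => g j x) := by
    ext x
    by_cases hx : ψ (x - z) = 0
    · simp [hx]
    · have hχ j : χ j (x - z) = 1 := hψχ (subset_tsupport _ hx) j
      simp [g, hχ, Pi.add_def]
  have hz := hρ (f z) (subset_closure (Set.mem_range_self z))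
  rw [localize]
  exact hM' _ g Φ (f z) (hψ.comp_sub z) g_mem (fun j => (hM j z).2) (hΦ.mono hz.1) hz.2

end WienerLevy

section Dilation

variable {V : Type*} [NormedAddCommGroup V] [NormedSpace ℝ V] {r : ℝ}

/-- The factor by which the dilation by `r` changes integrals:
`∫ f (r • ξ) dξ = dilationFactor V r * ∫ f ξ dξ`. -/
def dilationFactor (V : Type*) [AddCommGroup V] [Module ℝ V] (r : ℝ) : ℝ≥0 :=
  Real.toNNReal |(r ^ Module.finrank ℝ V)⁻¹|

variable [MeasurableSpace V] [BorelSpace V]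

theorem measurableEmbedding_smul (hr : r ≠ 0) : MeasurableEmbedding fun ξ : V => r • ξ :=
  (Homeomorph.smulOfNeZero r hr).measurableEmbedding

variable [FiniteDimensional ℝ V] {μ : Measure V} [μ.IsAddHaarMeasure]

theorem map_smul_eq (hr : r ≠ 0) :
    μ.map (fun ξ => r • ξ) = (dilationFactor V r : ℝ≥0∞) • μ :=
  Measure.map_addHaar_smul μ hr

theorem lintegral_comp_smul (hr : r ≠ 0) (f : V → ℝ≥0∞) :
    ∫⁻ ξ, f (r • ξ) ∂μ = dilationFactor V r * ∫⁻ ξ, f ξ ∂μ := by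
  rw [← (measurableEmbedding_smul hr).lintegral_map, map_smul_eq hr, lintegral_smul_measure,
    smul_eq_mul]

theorem eLpNorm_two_comp_smul {E : Type*} [NormedAddCommGroup E] (hr : r ≠ 0) (f : V → E) :
    eLpNorm (fun ξ => f (r • ξ)) 2 μ = NNReal.sqrt (dilationFactor V r) * eLpNorm f 2 μ := by
  refine (ENNReal.pow_right_strictMono two_ne_zero).injective ?_
  rw [mul_pow, eLpNorm_two_sq, eLpNorm_two_sq, lintegral_comp_smul hr fun ξ => ‖f ξ‖ₑ ^ 2,
    ← ENNReal.coe_pow, NNReal.sq_sqrt]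

theorem memLp_comp_smul {E : Type*} [NormedAddCommGroup E] {p : ℝ≥0∞} {f : V → E} (hr : r ≠ 0)
    (hf : MemLp f p μ) : MemLp (fun ξ => f (r • ξ)) p μ := by
  refine (measurableEmbedding_smul hr).memLp_map_measure_iff.1 ?_
  rw [map_smul_eq hr]
  exact hf.smul_measure ENNReal.coe_ne_top

end Dilation

theorem ConvLEWith.comp_smul {V : Type*} [NormedAddCommGroup V] [NormedSpace ℝ V]
    [FiniteDimensional ℝ V] [MeasureSpace V] [BorelSpace V]
    [(volume : Measure V).IsAddHaarMeasure] {C : ℝ≥0} {v₁ v₂ v : V → ℝ} {r : ℝ}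
    (h : ConvLEWith C v₁ v₂ v) (hr : r ≠ 0) :
    ConvLEWith (NNReal.sqrt (dilationFactor V r) * C) (fun ξ => v₁ (r • ξ)) (fun ξ => v₂ (r • ξ))
      (fun ξ => v (r • ξ)) := by
  intro ξ
  calc ∫⁻ η, ENNReal.ofReal (1 / v₁ (r • η) ^ 2) * ENNReal.ofReal (1 / v₂ (r • (ξ - η)) ^ 2)
      = dilationFactor V r *
          ∫⁻ η, ENNReal.ofReal (1 / v₁ η ^ 2) * ENNReal.ofReal (1 / v₂ (r • ξ - η) ^ 2) := by
        simp_rw [smul_sub]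
        exact lintegral_comp_smul hr fun η =>
          ENNReal.ofReal (1 / v₁ η ^ 2) * ENNReal.ofReal (1 / v₂ (r • ξ - η) ^ 2)
    _ ≤ dilationFactor V r * ENNReal.ofReal (C ^ 2 / v (r • ξ) ^ 2) := by
        gcongr
        exact h _
    _ = _ := by
        rw [← ENNReal.ofReal_coe_nnreal, ← ENNReal.ofReal_mul (NNReal.coe_nonneg _),
          ← mul_div_assoc, NNReal.coe_mul, mul_pow, ← NNReal.coe_pow (NNReal.sqrt _),
          NNReal.sq_sqrt]

section Bracket

variable {n : ℕ}

theorem bracket_sq (ξ : Rn n) : bracket ξ ^ 2 = 1 + ‖ξ‖ ^ 2 := Real.sq_sqrt (by positivity)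

theorem one_le_bracket (ξ : Rn n) : 1 ≤ bracket ξ :=
  Real.one_le_sqrt.2 (by linarith [sq_nonneg ‖ξ‖])

theorem bracket_le_one_add_norm (ξ : Rn n) : bracket ξ ≤ 1 + ‖ξ‖ :=
  Real.sqrt_le_iff.2 ⟨by positivity, by nlinarith [norm_nonneg ξ]⟩

theorem norm_le_bracket (ξ : Rn n) : ‖ξ‖ ≤ bracket ξ :=
  Real.le_sqrt_of_sq_le (by linarith)

theorem bracket_add_le (ξ η : Rn n) : bracket (ξ + η) ≤ bracket ξ + bracket η := by
  have norm_mul_le : ‖ξ‖ * ‖η‖ ≤ bracket ξ * bracket η :=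
    mul_le_mul (norm_le_bracket ξ) (norm_le_bracket η) (norm_nonneg η)
      (zero_le_one.trans (one_le_bracket ξ))
  have norm_add_sq_le : ‖ξ + η‖ ^ 2 ≤ (‖ξ‖ + ‖η‖) ^ 2 := by
    gcongr
    exact norm_add_le ξ η
  refine Real.sqrt_le_iff.2 ⟨by linarith [one_le_bracket ξ, one_le_bracket η], ?_⟩
  linear_combination norm_add_sq_le + 2 * norm_mul_le - bracket_sq ξ - bracket_sq η

theorem isWeight_bracket : IsWeight (bracket : Rn n → ℝ) where
  measurable := (Real.continuous_sqrt.comp (by fun_prop)).measurable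
  pos ξ := one_pos.trans_le (one_le_bracket ξ)

theorem bracket_smul_le {r : ℝ} (hr : 1 ≤ r) (ξ : Rn n) : bracket (r • ξ) ≤ r * (1 + ‖ξ‖) := by
  refine (bracket_le_one_add_norm _).trans ?_
  rw [norm_smul, Real.norm_of_nonneg (zero_le_one.trans hr)]
  linarith

end Bracket

section DilatedWeights

variable {n : ℕ} {k k₁ k₂ : Rn n → ℝ} {r : ℝ}

theorem IsWeight.comp_smul (hk : IsWeight k) (r : ℝ) : IsWeight fun ξ => k (r • ξ) :=
  ⟨hk.measurable.comp (measurable_const_smul r), fun _ => hk.pos _⟩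

theorem isModerate_comp_smul (hk : k ∈ Kpol n) (hr : 1 ≤ r) :
    IsModerate fun ξ => k (r • ξ) := by
  obtain ⟨measurable, pos, C, N, hC, -, growth⟩ := hk
  have r_pos : 0 < r := one_pos.trans_le hr
  refine ⟨IsWeight.comp_smul ⟨measurable, pos⟩ r, C * r ^ ⌈N⌉₊, ⌈N⌉₊, by positivity,
    fun ξ η => ?_⟩
  have bracket_rpow_le : bracket (r • ξ) ^ N ≤ (r * (1 + ‖ξ‖)) ^ ⌈N⌉₊ := by
    have one_le := one_le_bracket (r • ξ)
    calc bracket (r • ξ) ^ N ≤ bracket (r • ξ) ^ (⌈N⌉₊ : ℝ) :=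
          Real.rpow_le_rpow_of_exponent_le one_le (Nat.le_ceil N)
      _ = bracket (r • ξ) ^ ⌈N⌉₊ := Real.rpow_natCast _ _
      _ ≤ _ := by
        gcongr
        exact bracket_smul_le hr ξ
  have hkη := pos (r • η)
  calc k (r • (ξ + η)) ≤ C * bracket (r • ξ) ^ N * k (r • η) := smul_add r ξ η ▸ growth _ _
    _ ≤ C * (r * (1 + ‖ξ‖)) ^ ⌈N⌉₊ * k (r • η) := by gcongr
    _ = _ := by rw [mul_pow, ← mul_assoc C]

theorem ConvLE.exists_convLEWith_comp_smul (h : ConvLE k₁ k₂ k) (hr : r ≠ 0) :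
    ∃ C, ConvLEWith C (fun ξ => k₁ (r • ξ)) (fun ξ => k₂ (r • ξ)) (fun ξ => k (r • ξ)) := by
  obtain ⟨C, hC, h⟩ := h
  lift C to ℝ≥0 using hC.le
  exact ⟨_, ConvLEWith.comp_smul h hr⟩

theorem exists_isWienerLevyWeight_comp_smul (hk : k ∈ KWL n) (hr : 1 ≤ r) :
    ∃ δ, IsWienerLevyWeight (fun ξ => k (r • ξ)) δ := by
  obtain ⟨⟨hpol, hconv⟩, δ, hδ0, hδ1, ⟨-, hconvδ⟩, hmem, hconvb⟩ := hk
  have r_ne : r ≠ 0 := (one_pos.trans_le hr).ne'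
  obtain ⟨C, hC⟩ := hconvb.exists_convLEWith_comp_smul r_ne
  exact ⟨δ, {
    toIsModerate := isModerate_comp_smul hpol hr
    delta_pos := hδ0
    delta_lt_one := hδ1
    memLp := memLp_comp_smul r_ne hmem
    exists_convLE := hconv.exists_convLEWith_comp_smul r_ne
    exists_convLE_rpow := hconvδ.exists_convLEWith_comp_smul r_ne
    exists_convLE_inv_mul := ⟨C, fun ξ => bracket (r • ξ), isWeight_bracket.comp_smul r,
      fun ξ η => (congrArg bracket (smul_add r ξ η)).trans_le (bracket_add_le _ _), hC⟩ }⟩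

end DilatedWeights

section SpaceBk

variable {n : ℕ} {k : Rn n → ℝ} {K M : ℝ≥0} {T : 𝓢'(Rn n, ℂ)} {γ : Rn n → ℂ}

/-- The weight `k` as a function of the frequencies of Mathlib's Fourier transform, whose character
is `e^{-2πi⟨x,ξ⟩}`. -/
def freqWeight (k : Rn n → ℝ) : Rn n → ℝ := fun ξ => k ((2 * Real.pi) • ξ)

theorem exists_isWienerLevyWeight_freqWeight (hk : k ∈ KWL n) :
    ∃ δ, IsWienerLevyWeight (freqWeight k) δ :=
  exists_isWienerLevyWeight_comp_smul hk (by linarith [Real.pi_gt_three])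

/-- The tempered distribution `T` is the function `γ`. -/
def IsGivenBy (T : 𝓢'(Rn n, ℂ)) (γ : Rn n → ℂ) : Prop :=
  ∀ φ : 𝓢(Rn n, ℂ), T φ = ∫ x, φ x * γ x

theorem exists_memBall_of_normBk_lt (hk : IsAlgebraWeight (freqWeight k) K)
    (hT : normBk k T < M) : ∃ γ, IsGivenBy T γ ∧
      MemBall (freqWeight k) γ (NNReal.sqrt (dilationFactor (Rn n) (2 * Real.pi)) * M) := by
  obtain ⟨g, hgM⟩ := iInf_lt_iff.1 hT
  obtain ⟨⟨hg, fourier_apply⟩, eLpNorm_lt⟩ := iInf_lt_iff.1 hgM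
  let G : Rn n → ℂ := fun ξ => g ((2 * Real.pi) • ξ)
  have eLpNorm_le : eLpNorm (fun ξ => (freqWeight k ξ : ℂ) * G ξ) 2 volume ≤
      (NNReal.sqrt (dilationFactor (Rn n) (2 * Real.pi)) * M : ℝ≥0) := by
    refine (eLpNorm_two_comp_smul Real.two_pi_pos.ne' fun ξ => (k ξ : ℂ) * g ξ).trans_le ?_
    rw [ENNReal.coe_mul]
    gcongr
  have integrable : Integrable G := hk.integrable_of_eLpNorm_le
    (hg.aestronglyMeasurable.comp_quasiMeasurePreserving
      (Measure.quasiMeasurePreserving_smul volume Real.two_pi_pos.ne')) eLpNorm_le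
  refine ⟨𝓕⁻ G, fun φ => ?_, G, integrable, eLpNorm_le, rfl⟩
  calc T φ = (𝓕 T) (𝓕⁻ φ) := by
        rw [TemperedDistribution.fourier_apply, FourierTransform.fourier_fourierInv_eq]
    _ = ∫ ξ, (𝓕⁻ φ : 𝓢(Rn n, ℂ)) ξ * G ξ := fourier_apply _
    _ = ∫ x, φ x * 𝓕⁻ G x := by
        rw [SchwartzMap.fourierInv_coe, integral_fourierInv_mul_eq φ.integrable integrable]

theorem IsGivenBy.isFourierTransform (hT : IsGivenBy T γ) {G : Rn n → ℂ} (hG : Integrable G)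
    (hγ : γ = 𝓕⁻ G) : IsFourierTransform T fun ξ => G ((2 * Real.pi)⁻¹ • ξ) := by
  refine ⟨(hG.comp_smul (inv_ne_zero Real.two_pi_pos.ne')).locallyIntegrable, fun φ => ?_⟩
  calc (𝓕 T) φ = ∫ x, (𝓕 φ : 𝓢(Rn n, ℂ)) x * 𝓕⁻ G x := by
        rw [TemperedDistribution.fourier_apply, hT, hγ]
    _ = ∫ ξ, φ ξ * G ξ := by
        rw [← integral_fourierInv_mul_eq (𝓕 φ).integrable hG, ← SchwartzMap.fourierInv_coe,
          FourierTransform.fourierInv_fourier_eq]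
    _ = _ := by simp_rw [inv_smul_smul₀ Real.two_pi_pos.ne']

theorem IsGivenBy.mem_Bk_and_normBk_le (hT : IsGivenBy T γ) (hk : IsWeight (freqWeight k))
    (hγ : MemBall (freqWeight k) γ M) : T ∈ Bk k ∧
      normBk k T ≤ (NNReal.sqrt (dilationFactor (Rn n) (2 * Real.pi)⁻¹) * M : ℝ≥0) := by
  obtain ⟨G, integrable, eLpNorm_le, eq_fourierInv⟩ := hγ
  have inv_ne : (2 * Real.pi)⁻¹ ≠ 0 := inv_ne_zero Real.two_pi_pos.ne'
  have isFT := hT.isFourierTransform integrable eq_fourierInv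
  have weight_mul_eq : (fun ξ => (k ξ : ℂ) * G ((2 * Real.pi)⁻¹ • ξ)) =
      fun ξ => (freqWeight k ((2 * Real.pi)⁻¹ • ξ) : ℂ) * G ((2 * Real.pi)⁻¹ • ξ) := by
    simp_rw [freqWeight, smul_inv_smul₀ Real.two_pi_pos.ne']
  have memLp : MemLp (fun ξ => (freqWeight k ξ : ℂ) * G ξ) 2 volume :=
    ⟨hk.aestronglyMeasurable.mul integrable.aestronglyMeasurable,
      eLpNorm_le.trans_lt ENNReal.coe_lt_top⟩
  refine ⟨⟨_, isFT, weight_mul_eq ▸ memLp_comp_smul inv_ne memLp⟩,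
    (iInf₂_le _ isFT).trans ?_⟩
  rw [weight_mul_eq, eLpNorm_two_comp_smul inv_ne fun ξ => (freqWeight k ξ : ℂ) * G ξ,
    ENNReal.coe_mul]
  gcongr

end SpaceBk

section SmoothDivision

variable {V : Type*} [NormedAddCommGroup V] [NormedSpace ℝ V]

theorem contDiff_div_of_ne_zero {φ S : V → ℂ} (hφ : ContDiff ℝ ∞ φ) (hS : ContDiff ℝ ∞ S)
    (h : ∀ x ∈ tsupport φ, S x ≠ 0) : ContDiff ℝ ∞ (φ / S) := by
  refine contDiff_iff_contDiffAt.2 fun x => ?_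
  by_cases hx : x ∈ tsupport φ
  · rw [div_eq_mul_inv]
    exact hφ.contDiffAt.mul (hS.contDiffAt.inv (h x hx))
  · have eventually_zero : φ / S =ᶠ[nhds x] fun _ => 0 := by
      filter_upwards [notMem_tsupport_iff_eventuallyEq.1 hx] with y hy
      simp [hy]
    exact contDiffAt_const.congr_of_eventuallyEq eventually_zero

theorem exists_sum_mul_eq {ι : Type*} (F : Finset ι) {η : ι → V → ℂ}
    (hη : ∀ i, ContDiff ℝ ∞ (η i)) {t : V → ℂ} (ht : ContDiff ℝ ∞ t) (htc : HasCompactSupport t)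
    (cover : ∀ x ∈ tsupport t, ∃ i ∈ F, η i x ≠ 0) :
    ∃ φ : ι → V → ℂ, (∀ i, ContDiff ℝ ∞ (φ i)) ∧ (∀ i, HasCompactSupport (φ i)) ∧
      t = ∑ i ∈ F, η i * φ i := by
  let S : V → ℂ := ∑ i ∈ F, star (η i) * η i
  have smooth_star (i) : ContDiff ℝ ∞ (star (η i)) := Complex.conjCLE.contDiff.comp (hη i)
  have smooth_S : ContDiff ℝ ∞ S := by
    rw [show S = fun x => ∑ i ∈ F, star (η i) x * η i x by ext x; simp [S]]
    exact ContDiff.sum fun i _ => (smooth_star i).mul (hη i)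
  have S_ne_zero (x) (hx : x ∈ tsupport t) : S x ≠ 0 := by
    obtain ⟨i, hi, hix⟩ := cover x hx
    have S_eq : S x = ((∑ i ∈ F, Complex.normSq (η i x) : ℝ) : ℂ) := by
      simp [S, Complex.normSq_eq_conj_mul_self]
    have sum_pos : 0 < ∑ i ∈ F, Complex.normSq (η i x) :=
      Finset.sum_pos' (fun _ _ => Complex.normSq_nonneg _) ⟨i, hi, Complex.normSq_pos.2 hix⟩
    exact S_eq ▸ Complex.ofReal_ne_zero.2 sum_pos.ne'
  refine ⟨fun i => star (η i) * (t / S),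
    fun i => (smooth_star i).mul (contDiff_div_of_ne_zero ht smooth_S S_ne_zero),
    fun i => (div_eq_mul_inv t S ▸ htc.mul_right).mul_left, ?_⟩
  calc t = S * (t / S) := by
        ext x
        by_cases hx : x ∈ tsupport t
        · exact (mul_div_cancel₀ _ (S_ne_zero x hx)).symm
        · simp [image_eq_zero_of_notMem_tsupport hx]
    _ = ∑ i ∈ F, η i * (star (η i) * (t / S)) := by
        rw [Finset.sum_mul]
        exact Finset.sum_congr rfl fun i _ => by ring

end SmoothDivision

section Gluing

variable {n : ℕ} {u : Distr n} {f : Rn n → ℂ}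

/-- The smooth function `f` with compact support as an element of `Test n`. -/
def mkTest (f : Rn n → ℂ) (hf : ContDiff ℝ ∞ f) (hc : HasCompactSupport f) : Test n where
  toFun := f
  contDiff' := hf
  hasCompactSupport' := hc
  tsupport_subset' := fun _ _ => trivial

theorem cutoff_apply (χ : Test n) (u : Distr n) (φ : 𝓢(Rn n, ℂ)) {t : Test n}
    (ht : ⇑t = ⇑χ * ⇑φ) : cutoff χ u φ = u t := by
  have t_eq : t = TestFunction.ofSupportedInCLM ℂ (Ω := (⊤ : Opens (Rn n))) (fun _ _ => trivial)
      (mulLM χ φ) := DFunLike.coe_injective ht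
  rw [t_eq]
  rfl

theorem IsGivenBy.apply_eq_integral {χ : Test n} {γ φ : Rn n → ℂ} (h : IsGivenBy (cutoff χ u) γ)
    (hφ : ContDiff ℝ ∞ φ) (hφc : HasCompactSupport φ) {t : Test n} (ht : ⇑t = ⇑χ * φ) :
    u t = ∫ x, φ x * γ x := by
  rw [← cutoff_apply χ u (hφc.toSchwartzMap hφ) ht, h]
  rfl

theorem ofFun_apply (hf : Continuous f) (t : Test n) : ofFun f t = ∫ x, t x * f x := by
  rw [ofFun, TestFunction.integralAgainstBilinCLM_eq_integral
    (hf.locallyIntegrable.locallyIntegrableOn _)]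
  rfl

theorem isGivenBy_cutoff_ofFun (hf : Continuous f) (χ : Test n) :
    IsGivenBy (cutoff χ (ofFun f)) (⇑χ * f) := by
  intro φ
  rw [cutoff_apply χ (ofFun f) φ (t := mkTest (⇑χ * ⇑φ) (χ.contDiff.mul (φ.smooth ⊤))
    χ.hasCompactSupport.mul_right) rfl, ofFun_apply hf]
  refine integral_congr_ae (ae_of_all _ fun x => ?_)
  change χ x * φ x * f x = φ x * (χ x * f x)
  ring

theorem eq_of_integral_mul_eq {g : Rn n → ℂ} (hf : Continuous f) (hg : Continuous g)
    (h : ∀ φ : Rn n → ℂ, ContDiff ℝ ∞ φ → HasCompactSupport φ →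
      ∫ x, φ x * f x = ∫ x, φ x * g x) : f = g := by
  have ae_eq : f =ᵐ[volume] g := by
    refine ae_eq_of_integral_contDiff_smul_eq hf.locallyIntegrable hg.locallyIntegrable
      fun φ hφ hφc => ?_
    simpa using h (fun x => (φ x : ℂ)) (Complex.ofRealCLM.contDiff.comp hφ)
      (hφc.comp_left (g := fun t : ℝ => (t : ℂ)) rfl)
  exact (hf.ae_eq_iff_eq volume hg).1 ae_eq

theorem ofFun_injective {g : Rn n → ℂ} (hf : Continuous f) (hg : Continuous g)
    (h : ofFun f = ofFun g) : f = g :=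
  eq_of_integral_mul_eq hf hg fun φ hφ hφc => by
    have apply_eq := congrArg (fun u : Distr n => u (mkTest φ hφ hφc)) h
    simpa only [ofFun_apply hf, ofFun_apply hg] using! apply_eq

theorem IsGivenBy.mul_eq_mul {χ χ' : Test n} {γ γ' : Rn n → ℂ} (h : IsGivenBy (cutoff χ u) γ)
    (h' : IsGivenBy (cutoff χ' u) γ') (hγ : Continuous γ) (hγ' : Continuous γ') :
    ⇑χ' * γ = ⇑χ * γ' := by
  refine eq_of_integral_mul_eq (χ'.continuous.mul hγ) (χ.continuous.mul hγ') fun φ hφ hφc => ?_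
  let t : Test n := mkTest (⇑χ * (φ * ⇑χ')) (χ.contDiff.mul (hφ.mul χ'.contDiff))
    hφc.mul_right.mul_left
  have apply_eq : u t = ∫ x, (φ * ⇑χ') x * γ x :=
    h.apply_eq_integral (hφ.mul χ'.contDiff) hφc.mul_right rfl
  have apply_eq' : u t = ∫ x, (φ * ⇑χ) x * γ' x :=
    h'.apply_eq_integral (hφ.mul χ.contDiff) hφc.mul_right
      (show ⇑χ * (φ * ⇑χ') = ⇑χ' * (φ * ⇑χ) by ring)
  simpa only [Pi.mul_apply, mul_assoc] using apply_eq.symm.trans apply_eq'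

theorem eq_ofFun_of_isGivenBy_cutoff {ι : Type*} (hf : Continuous f) {η : ι → Test n}
    (hη : ∀ x, ∃ i, η i x ≠ 0) (h : ∀ i, IsGivenBy (cutoff (η i) u) (⇑(η i) * f)) :
    u = ofFun f := by
  ext t
  choose i hi using hη
  obtain ⟨F, -, cover⟩ := t.hasCompactSupport.isCompact.elim_nhds_subcover
    (fun x => {y | η (i x) y ≠ 0}) fun x _ =>
      (isOpen_ne_fun (η (i x)).continuous continuous_const).mem_nhds (hi x)
  obtain ⟨φ, smooth, compact, t_eq⟩ := exists_sum_mul_eq F (fun x => (η (i x)).contDiff)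
    t.contDiff t.hasCompactSupport fun y hy => by simpa using cover hy
  let s (x : Rn n) : Test n := mkTest (⇑(η (i x)) * φ x) ((η (i x)).contDiff.mul (smooth x))
    (compact x).mul_left
  have t_eq_sum : t = ∑ x ∈ F, s x := by
    refine DFunLike.coe_injective (t_eq.trans ?_)
    rw [FunLike.coe_sum]
    rfl
  have apply_s (x : Rn n) : u (s x) = ofFun f (s x) := by
    rw [ofFun_apply hf, (h (i x)).apply_eq_integral (smooth x) (compact x) rfl]
    refine integral_congr_ae (ae_of_all _ fun y => ?_)
    change φ x y * (η (i x) y * f y) = η (i x) y * φ x y * f y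
    ring
  rw [t_eq_sum, map_sum, map_sum, Finset.sum_congr rfl fun x _ => apply_s x]

end Gluing

theorem unifLocMem_of_memBall_mul {V : Type*} [NormedAddCommGroup V] [InnerProductSpace ℝ V]
    [FiniteDimensional ℝ V] [MeasurableSpace V] [BorelSpace V] {w : V → ℝ} {K M : ℝ≥0}
    {f χ : V → ℂ} (hw : IsModerate w) (hK : IsAlgebraWeight w K) (hχ : ContDiff ℝ ∞ χ) {x₀ : V}
    (hx₀ : χ x₀ ≠ 0) (h : ∀ y, MemBall w (fun x => χ (x - y) * f x) M) : UnifLocMem w f := by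
  have continuous_shift : Continuous fun x => χ (x + x₀) :=
    hχ.continuous.comp (continuous_id.add continuous_const)
  refine ⟨{x | χ (x + x₀) ≠ 0},
    (isOpen_ne_fun continuous_shift continuous_const).mem_nhds (by simpa using hx₀),
    fun θ hθ hθc tsupport_le => ?_⟩
  obtain ⟨L, hL⟩ := hw.exists_memBall (θ := θ / fun x => χ (x + x₀))
    (contDiff_div_of_ne_zero hθ (hχ.comp (contDiff_id.add contDiff_const)) tsupport_le)
    (div_eq_mul_inv θ _ ▸ hθc.mul_right)
  refine ⟨K * L * M, fun z => ?_⟩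
  convert (hL.comp_sub z).mul hK (h (z - x₀)) using 1
  ext x
  have sub_eq : x - (z - x₀) = x - z + x₀ := by abel
  simp only [Pi.mul_apply, Pi.div_apply, sub_eq]
  by_cases hx : θ (x - z) = 0
  · simp [hx]
  · have := tsupport_le (subset_tsupport _ hx)
    field_simp [show χ (x - z + x₀) ≠ 0 from this]

section BkInfty

variable {n : ℕ} {k : Rn n → ℝ} {K : ℝ≥0} {u : Distr n} {f : Rn n → ℂ}

theorem exists_eq_ofFun_of_mem_BkInfty (hw : IsModerate (freqWeight k))
    (hK : IsAlgebraWeight (freqWeight k) K) (hu : u ∈ BkInfty k) :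
    ∃ f : Rn n → ℂ, Continuous f ∧ UnifLocMem (freqWeight k) f ∧ u = ofFun f := by
  obtain ⟨χ, hχ, -, iSup_lt⟩ := hu
  obtain ⟨x₀, hx₀⟩ : ∃ x₀, χ x₀ ≠ 0 := by
    contrapose! hχ
    ext x
    exact hχ x
  obtain ⟨M, lt_M, -⟩ := ENNReal.lt_iff_exists_nnreal_btwn.1 iSup_lt
  choose γ cutoff_eq memBall using fun y => exists_memBall_of_normBk_lt hK
    ((le_iSup (fun y => normBk k (cutoff (translate y χ) u)) y).trans_lt lt_M)
  have compatible (y y' x : Rn n) : χ (x - y') * γ y x = χ (x - y) * γ y' x :=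
    congrFun ((cutoff_eq y).mul_eq_mul (cutoff_eq y') (memBall y).continuous
      (memBall y').continuous) x
  let f : Rn n → ℂ := fun x => γ (x - x₀) x / χ x₀
  have translate_mul (y : Rn n) : ⇑(translate y χ) * f = γ y := by
    ext x
    have := compatible (x - x₀) y x
    rw [sub_sub_cancel] at this
    change χ (x - y) * (γ (x - x₀) x / χ x₀) = γ y x
    rw [← mul_div_assoc, this, mul_div_cancel_left₀ _ hx₀]
  have unifLocMem : UnifLocMem (freqWeight k) f :=
    unifLocMem_of_memBall_mul hw hK χ.contDiff hx₀ fun y => (translate_mul y).symm ▸ memBall y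
  have continuous_f := (unifLocMem.uniformContinuous hK).continuous
  refine ⟨f, continuous_f, unifLocMem, eq_ofFun_of_isGivenBy_cutoff continuous_f
    (η := fun y => translate y χ) (fun x => ⟨x - x₀, ?_⟩)
    fun y => (translate_mul y).symm ▸ cutoff_eq y⟩
  change χ (x - (x - x₀)) ≠ 0
  rwa [sub_sub_cancel]

theorem ofFun_mem_BkInfty (hk : IsWeight (freqWeight k)) (hf : Continuous f)
    (hfk : UnifLocMem (freqWeight k) f) : ofFun f ∈ BkInfty k := by
  obtain ⟨θ, smooth, compact, -, eq_one, -, M, memBall⟩ := hfk.exists_cutoff Filter.univ_mem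
  let χ : Test n := mkTest θ smooth compact
  have χ_zero : χ 0 = 1 := eq_one.self_of_nhds
  have mem_Bk (y : Rn n) := (isGivenBy_cutoff_ofFun hf (translate y χ)).mem_Bk_and_normBk_le hk
    (memBall y)
  exact ⟨χ, fun h => by simp [h] at χ_zero, fun y => (mem_Bk y).1,
    (iSup_le fun y => (mem_Bk y).2).trans_lt ENNReal.coe_lt_top⟩

end BkInfty

end KatoSobolev

end

theorem mainTheorem1 {n d : ℕ} (k : KatoSobolev.Rn n → ℝ) (hk : k ∈ KatoSobolev.KWL n)
    (Ω : Set (Fin d → ℂ)) (hΩ : IsOpen Ω) (Φ : (Fin d → ℂ) → ℂ) (hΦ : DifferentiableOn ℂ Φ Ω)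
    (u : Fin d → KatoSobolev.Distr n) (hu : ∀ j, u j ∈ KatoSobolev.BkInfty k) :
    -- `u` is given by a bounded continuous function
    (∃ f : KatoSobolev.Rn n → (Fin d → ℂ), Continuous f ∧ Bornology.IsBounded (Set.range f) ∧
      ∀ j, u j = KatoSobolev.ofFun (fun x => f x j)) ∧
    -- and if the closure of its range lies in `Ω`, then `Φ ∘ u` belongs to the space
    (∀ f : KatoSobolev.Rn n → (Fin d → ℂ), Continuous f →
      (∀ j, u j = KatoSobolev.ofFun (fun x => f x j)) →
      closure (Set.range f) ⊆ Ω →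
      KatoSobolev.ofFun (fun x => Φ (f x)) ∈ KatoSobolev.BkInfty k) := by
  obtain ⟨δ, hw⟩ := KatoSobolev.exists_isWienerLevyWeight_freqWeight hk
  obtain ⟨K, hK⟩ := hw.exists_isAlgebraWeight
  choose f₀ continuous_f₀ unifLocMem_f₀ u_eq using fun j =>
    KatoSobolev.exists_eq_ofFun_of_mem_BkInfty hw.toIsModerate hK (hu j)
  refine ⟨⟨fun x j => f₀ j x, continuous_pi continuous_f₀,
    KatoSobolev.UnifLocMem.isBounded_range hK unifLocMem_f₀, u_eq⟩, fun f hf hfu hfΩ => ?_⟩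
  have f₀_eq (j : Fin d) : f₀ j = fun x => f x j :=
    KatoSobolev.ofFun_injective (continuous_f₀ j) ((continuous_apply j).comp hf)
      ((u_eq j).symm.trans (hfu j))
  have unifLocMem_f (j : Fin d) : KatoSobolev.UnifLocMem (KatoSobolev.freqWeight k)
      fun x => f x j := f₀_eq j ▸ unifLocMem_f₀ j
  have unifLocMem_comp := hw.unifLocMem_comp unifLocMem_f hΩ hΦ hfΩ
  exact KatoSobolev.ofFun_mem_BkInfty hK.toIsWeight
    (unifLocMem_comp.uniformContinuous hK).continuous unifLocMem_comp
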